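/- Let $n,m\in\mathbb N_0$ and let $J,R,Q\in\mathbb R^{n\times n}$, $B,P\in\mathbb R^{n\times m}$, $D\in\mathbb R^{m\times m}$ satisfy $J=-J^\top$, $R=R^\top\ge 0$, $Q=Q^\top\ge 0$, $S:=\frac12(D+D^\top)\ge 0$ and $$\begin{pmatrix}QRQ & QP\\ P^\top Q & S\end{pmatrix}\ge 0 .$$ Let $\mathbb U\subset\mathbb R^m$ be convex and compact with $0\in\operatorname{int}\mathbb U$. Put $A:=(J-R)Q$ and consider the control system $$\dot x = Ax+(B-P)u,\qquad x(0)=x^0 .$$ For $t>0$ let $\mathcal R_t(x^0)$ be the set of all $z\in\mathbb R^n$ for which there is a control $u\in L^1(0,t;\mathbb U)$ whose state response (absolutely continuous solution) satisfies $x(t)=z$; let $\mathcal R_0(x^0):=\{x^0\}$ and $\mathcal R(x^0):=\bigcup_{t\ge 0}\mathcal R_t(x^0)$. The pair $(A,B-P)$ is called controllable if $\operatorname{rank}\,(B-P,\;A(B-P),\;\ldots,\;A^{n-1}(B-P))=n$. Suppose that $((J-R)Q,B-P)$ is controllable. There is a decomposition $\mathbb R^n=N_1\oplus N_2$ into $A$-invariant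 subspaces such that all (complex) eigenvalues of $A|_{N_1}$ lie on the imaginary axis and all (complex) eigenvalues of $A|_{N_2}$ have negative real part. Any such decomposition is $Q$-orthogonal, i.e. $\langle Qx_1,x_2\rangle=0$ for $x_1\in N_1$, $x_2\in N_2$ (which is expressed by writing $\oplus_Q$), and for every $x^0\in\mathbb R^n$ there is a bounded set $K_{x^0}\subset N_2$ such that $$N_1\oplus_Q(\mathcal R(0)\cap N_2)\;\subset\;\mathcal R(x^0)\;\subset\;N_1\oplus_Q K_{x^0},$$ where $N_1\oplus_Q M:=\{x_1+x_2 : x_1\in N_1,\ x_2\in M\}$ for $M\subset N_2$. In particular, $N_1$ is reachable from anywhere: $N_1\subset\mathcal R(x^0)$ for every $x^0\in\mathbb R^n$. -/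

import Mathlib

open MeasureTheory
open scoped Matrix Pointwise

noncomputable section

/-- The coefficient matrices of a (finite-dimensional, real, linear) port-Hamiltonian system with
feed-through
`x' = (J - R) Q x + (B - P) u`, `y = (B + P)ᵀ Q x + D u`. -/
structure PHSystem (n m : ℕ) where
  J : Matrix (Fin n) (Fin n) ℝ
  R : Matrix (Fin n) (Fin n) ℝ
  Q : Matrix (Fin n) (Fin n) ℝ
  B : Matrix (Fin n) (Fin m) ℝ
  P : Matrix (Fin n) (Fin m) ℝ
  D : Matrix (Fin m) (Fin m) ℝ
  J_skew : J = -Jᵀ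
  R_psd : R.PosSemidef
  Q_psd : Q.PosSemidef
  S_psd : ((1 / 2 : ℝ) • (D + Dᵀ)).PosSemidef
  W_psd : (Matrix.fromBlocks (Q * R * Q) (Q * P) (Pᵀ * Q) ((1 / 2 : ℝ) • (D + Dᵀ))).PosSemidef

/-- The drift matrix `A = (J - R) Q`. -/
def PHSystem.driftMatrix {n m : ℕ} (S : PHSystem n m) : Matrix (Fin n) (Fin n) ℝ :=
  (S.J - S.R) * S.Q

/-- The input matrix `B - P`. -/
def PHSystem.inputMatrix {n m : ℕ} (S : PHSystem n m) : Matrix (Fin n) (Fin m) ℝ :=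
  S.B - S.P

/-- The Kalman matrix `K(A, B) = (B, A B, …, A ^ (n - 1) B)`; the column with index `(k, j)` is
the `j`-th column of `A ^ k * B`. -/
def kalmanMatrix {n m : ℕ} (A : Matrix (Fin n) (Fin n) ℝ) (B : Matrix (Fin n) (Fin m) ℝ) :
    Matrix (Fin n) (Fin n × Fin m) ℝ :=
  Matrix.of fun i kj => (A ^ (kj.1 : ℕ) * B) i kj.2

/-- The pair `(A, B)` is controllable: `rank K(A, B) = n`. -/
def IsControllable {n m : ℕ} (A : Matrix (Fin n) (Fin n) ℝ) (B : Matrix (Fin n) (Fin m) ℝ) :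
    Prop :=
  (kalmanMatrix A B).rank = n

/-- `u` represents an element of `L¹(0, t; U)`. -/
def IsFeasibleControl {m : ℕ} (U : Set (Fin m → ℝ)) (t : ℝ) (u : ℝ → Fin m → ℝ) : Prop :=
  IntegrableOn u (Set.Icc 0 t) ∧ ∀ᵐ s ∂(volume.restrict (Set.Icc 0 t)), u s ∈ U

/-- `x` is the (Carathéodory) solution on `[0, t]` of `x' = A x + B u`, `x(0) = x₀`, where `u` is
integrable on `[0, t]`. -/
def IsStateResponse {n m : ℕ} (A : Matrix (Fin n) (Fin n) ℝ) (B : Matrix (Fin n) (Fin m) ℝ)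
    (x₀ : Fin n → ℝ) (u : ℝ → Fin m → ℝ) (t : ℝ) (x : ℝ → Fin n → ℝ) : Prop :=
  ContinuousOn x (Set.Icc 0 t) ∧
    ∀ s ∈ Set.Icc 0 t, x s = x₀ + ∫ τ in (0 : ℝ)..s, (A *ᵥ x τ + B *ᵥ u τ)

/-- The set `R_t(x₀)` of states that are reachable from `x₀` at time `t > 0` with controls in
`L¹(0, t; U)`. -/
def reachableAt {n m : ℕ} (A : Matrix (Fin n) (Fin n) ℝ) (B : Matrix (Fin n) (Fin m) ℝ)
    (U : Set (Fin m → ℝ)) (t : ℝ) (x₀ : Fin n → ℝ) : Set (Fin n → ℝ) :=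
  {z | ∃ u : ℝ → Fin m → ℝ, IsFeasibleControl U t u ∧
    ∃ x : ℝ → Fin n → ℝ, IsStateResponse A B x₀ u t x ∧ x t = z}

/-- The reachable set `R(x₀)`: the union of `R_0(x₀) = {x₀}` and of all `R_t(x₀)` with `t > 0`. -/
def reachableSet {n m : ℕ} (A : Matrix (Fin n) (Fin n) ℝ) (B : Matrix (Fin n) (Fin m) ℝ)
    (U : Set (Fin m → ℝ)) (x₀ : Fin n → ℝ) : Set (Fin n → ℝ) :=
  {x₀} ∪ ⋃ t ∈ Set.Ioi (0 : ℝ), reachableAt A B U t x₀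

/-- The set of complex eigenvalues of an endomorphism of a real vector space. -/
def complexSpectrum {V : Type*} [AddCommGroup V] [Module ℝ V] (T : V →ₗ[ℝ] V) : Set ℂ :=
  spectrum ℂ (LinearMap.baseChange ℂ T)

/-- `ℝⁿ = N₁ ⊕ N₂` with `A`-invariant subspaces `N₁`, `N₂` such that all eigenvalues of `A|N₁` are
purely imaginary and `A|N₂` is Hurwitz. -/
structure IsSpectralDecomposition {n : ℕ} (A : Matrix (Fin n) (Fin n) ℝ)
    (N₁ N₂ : Submodule ℝ (Fin n → ℝ)) : Prop where
  isCompl : IsCompl N₁ N₂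
  invariant₁ : ∀ x ∈ N₁, Matrix.toLin' A x ∈ N₁
  invariant₂ : ∀ x ∈ N₂, Matrix.toLin' A x ∈ N₂
  imaginary : ∀ z ∈ complexSpectrum ((Matrix.toLin' A).restrict invariant₁), z.re = 0
  hurwitz : ∀ z ∈ complexSpectrum ((Matrix.toLin' A).restrict invariant₂), z.re < 0

/-- Orthogonality of two subspaces with respect to the semi-inner product `[x, y] = ⟨Q x, y⟩`. -/
def IsQOrthogonal {n : ℕ} (Q : Matrix (Fin n) (Fin n) ℝ) (N₁ N₂ : Submodule ℝ (Fin n → ℝ)) :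
    Prop :=
  ∀ x ∈ N₁, ∀ y ∈ N₂, (Q *ᵥ x) ⬝ᵥ y = 0

end

/-! The energy form `β x y = ⟨x, Q y⟩` satisfies `β x (A x) ≤ 0`, and `β x x = 0` forces `Q x = 0`,
hence `A x = 0`. So no eigenvalue has positive real part, and splitting the characteristic
polynomial into coprime factors by the sign of the real part gives `N₁` and `N₂` as kernels.

Q-orthogonality (`form_eq_zero_of_tendsto`): the flow preserves `β x y` for `x ∈ N₁`, while `exp
(tA) y → 0` for `y ∈ N₂`; Cauchy–Schwarz for the semidefinite form concludes.

Upper inclusion: the projection onto `N₂` along `N₁` commutes with `A`, and exponential decay on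
`N₂` bounds the projected variation-of-constants formula uniformly in time.

Lower inclusion: `exists_mem_inputResponses` shows that every point of an invariant subspace without
eigenvalues of negative real part can be reached from `0`. Otherwise a functional `f` separates the
point from the convex union of all response sets. Concatenating controls makes `∑ |f (exp (jA) x)|`
bounded, so `f` tends to `0` along all orbits and vanishes on the subspace, a contradiction. Applied
to `A` on `N₁`, and to `-A` on the whole space to steer `x₀` to `0`, this yields the inclusion by
concatenation. -/

/-! ### The matrix exponential flow. -/

noncomputable section Flow

variable {V : Type*} [NormedAddCommGroup V] [NormedSpace ℝ V]

/-- The one-parameter group `exp (t A)` generated by a bounded operator `A`. -/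
def flow (A : V →L[ℝ] V) (t : ℝ) : V →L[ℝ] V := NormedSpace.exp (t • A)

@[simp]
theorem flow_zero (A : V →L[ℝ] V) : flow A 0 = 1 := by simp [flow]

theorem flow_neg_left (A : V →L[ℝ] V) (t : ℝ) : flow (-A) t = flow A (-t) := by
  simp [flow]

theorem commute_flow {A T : V →L[ℝ] V} (h : Commute T A) (t : ℝ) : Commute T (flow A t) := by
  let _ : NormedAlgebra ℚ (V →L[ℝ] V) := NormedAlgebra.restrictScalars ℚ ℝ _
  exact (h.smul_right t).exp_right

theorem flow_apply_comm (A : V →L[ℝ] V) (t : ℝ) (x : V) : flow A t (A x) = A (flow A t x) :=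
  (DFunLike.congr_fun (commute_flow (Commute.refl A) t) x).symm

variable [CompleteSpace V]

theorem flow_add (A : V →L[ℝ] V) (s t : ℝ) : flow A (s + t) = flow A s * flow A t := by
  have h : Commute (s • A) (t • A) := ((Commute.refl A).smul_left s).smul_right t
  rw [flow, add_smul, flow, flow]
  let _ : NormedAlgebra ℚ (V →L[ℝ] V) := NormedAlgebra.restrictScalars ℚ ℝ _
  exact NormedSpace.exp_add_of_commute h

theorem flow_add_apply (A : V →L[ℝ] V) (s t : ℝ) (x : V) :
    flow A (s + t) x = flow A s (flow A t x) := by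
  rw [flow_add]; rfl

@[simp]
theorem flow_apply_flow_neg (A : V →L[ℝ] V) (t : ℝ) (x : V) : flow A t (flow A (-t) x) = x := by
  rw [← flow_add_apply]; simp

theorem hasDerivAt_flow (A : V →L[ℝ] V) (t : ℝ) : HasDerivAt (flow A) (flow A t * A) t :=
  hasDerivAt_exp_smul_const A t

theorem continuous_flow (A : V →L[ℝ] V) : Continuous (flow A) :=
  continuous_iff_continuousAt.2 fun t ↦ (hasDerivAt_flow A t).continuousAt

theorem continuous_flow_apply (A : V →L[ℝ] V) (x : V) : Continuous fun t ↦ flow A t x :=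
  (continuous_flow A).clm_apply continuous_const

theorem hasDerivAt_flow_apply (A : V →L[ℝ] V) (x : V) (t : ℝ) :
    HasDerivAt (fun s ↦ flow A s x) (flow A t (A x)) t := by
  simpa using (hasDerivAt_flow A t).clm_apply (hasDerivAt_const t x)

theorem flow_mem {A : V →L[ℝ] V} {N : Submodule ℝ V} (hN : IsClosed (N : Set V))
    (hA : ∀ x ∈ N, A x ∈ N) (t : ℝ) {x : V} (hx : x ∈ N) : flow A t x ∈ N := by
  have h1 : HasSum (fun k : ℕ ↦ ((k.factorial : ℝ)⁻¹ • (t • A) ^ k) x) (flow A t x) :=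
    (NormedSpace.exp_series_hasSum_exp' (𝕂 := ℝ) (t • A)).mapL
      (ContinuousLinearMap.apply ℝ V x)
  have hk : ∀ k : ℕ, ((t • A) ^ k) x ∈ N := by
    intro k
    induction k with
    | zero => simpa using hx
    | succ k ih =>
      rw [pow_succ']
      exact N.smul_mem _ (hA _ ih)
  exact hN.mem_of_tendsto h1 (Filter.Eventually.of_forall fun s ↦
    N.sum_mem fun k _ ↦ N.smul_mem _ (hk k))

end Flow

/-! ### Integration by parts for absolutely continuous functions. -/

/-- Controls are only integrable, so the state `F` is merely absolutely continuous and the product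
rule is available only almost everywhere. -/
theorem integral_mul_by_parts {k k' f F : ℝ → ℝ} {t c : ℝ} (ht : 0 ≤ t)
    (hk : ∀ s, HasDerivAt k (k' s) s) (hk' : Continuous k')
    (hf : IntervalIntegrable f volume 0 t)
    (hF : ∀ s ∈ Set.Icc 0 t, F s = c + ∫ r in (0 : ℝ)..s, f r) :
    ∫ s in (0 : ℝ)..t, (k' s * F s + k s * f s) = k t * F t - k 0 * c := by
  have hkac : AbsolutelyContinuousOnInterval k 0 t := by
    have h1 : AbsolutelyContinuousOnInterval (fun x ↦ ∫ r in (0 : ℝ)..x, k' r) 0 t :=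
      (hk'.intervalIntegrable 0 t).absolutelyContinuousOnInterval_intervalIntegral (by simp)
    have h2 : AbsolutelyContinuousOnInterval (fun _ : ℝ ↦ k 0) 0 t :=
      (LipschitzWith.const (k 0)).lipschitzOnWith.absolutelyContinuousOnInterval
    convert! h2.add h1 using 1
    ext x
    simp [intervalIntegral.integral_eq_sub_of_hasDerivAt (fun s _ ↦ hk s)
      (hk'.intervalIntegrable 0 x)]
  set G : ℝ → ℝ := fun s ↦ c + ∫ r in (0 : ℝ)..s, f r
  have hGac : AbsolutelyContinuousOnInterval G 0 t := by
    have h1 := hf.absolutelyContinuousOnInterval_intervalIntegral (c := 0) (by simp)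
    have h2 : AbsolutelyContinuousOnInterval (fun _ : ℝ ↦ c) 0 t :=
      (LipschitzWith.const c).lipschitzOnWith.absolutelyContinuousOnInterval
    exact h2.add h1
  have h := hkac.integral_deriv_mul_eq_sub hGac
  have e1 : G t = F t := (hF t ⟨ht, le_rfl⟩).symm
  have e0 : G 0 = c := by simp [G]
  rw [e1, e0] at h
  rw [← h]
  refine intervalIntegral.integral_congr_ae ?_
  filter_upwards [hf.ae_hasDerivAt_integral] with s hs hs'
  have hd : HasDerivAt G (f s) s :=
    (hs (Set.uIoc_subset_uIcc hs') 0 (by simp)).const_add c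
  rw [Set.uIoc_of_le ht] at hs'
  rw [(hk s).deriv, hd.deriv, hF s ⟨hs'.1.le, hs'.2⟩]

theorem clm_pi_apply_eq_sum {m : ℕ} {E : Type*} [NormedAddCommGroup E] [NormedSpace ℝ E]
    (T : (Fin m → ℝ) →L[ℝ] E) (x : Fin m → ℝ) : T x = ∑ j, x j • T (Pi.single j 1) := by
  conv_lhs => rw [← Finset.univ_sum_single x]
  rw [map_sum]
  refine Finset.sum_congr rfl fun j _ ↦ ?_
  rw [← map_smul, ← Pi.single_smul, smul_eq_mul, mul_one]

theorem intervalIntegrable_clm_apply {m : ℕ} {E : Type*} [NormedAddCommGroup E] [NormedSpace ℝ E]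
    {K : ℝ → (Fin m → ℝ) →L[ℝ] E} {f : ℝ → Fin m → ℝ} {a b : ℝ} (hK : Continuous K)
    (hf : IntervalIntegrable f volume a b) :
    IntervalIntegrable (fun s ↦ K s (f s)) volume a b := by
  have hfj : ∀ j, IntervalIntegrable (fun s ↦ f s j) volume a b := fun j ↦
    ⟨hf.1.eval j, hf.2.eval j⟩
  have h := IntervalIntegrable.sum Finset.univ fun j _ ↦
    (hfj j).smul_continuousOn (g := fun s ↦ K s (Pi.single j 1))
      (hK.clm_apply continuous_const).continuousOn
  have he : (fun s ↦ K s (f s)) = ∑ j, fun s ↦ f s j • K s (Pi.single j 1) := by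
    funext s
    rw [Finset.sum_apply, clm_pi_apply_eq_sum]
  rwa [he]

/-- Reduces to the scalar case entry by entry. With `K = flow (∓A)` it yields both directions of the
variation-of-constants formula. -/
theorem integral_clm_apply_by_parts {n : ℕ} {K K' : ℝ → (Fin n → ℝ) →L[ℝ] (Fin n → ℝ)}
    {f F : ℝ → Fin n → ℝ} {t : ℝ} {c : Fin n → ℝ} (ht : 0 ≤ t)
    (hK : ∀ s, HasDerivAt K (K' s) s) (hK' : Continuous K')
    (hf : IntervalIntegrable f volume 0 t)
    (hF : ∀ s ∈ Set.Icc 0 t, F s = c + ∫ r in (0 : ℝ)..s, f r) :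
    ∫ s in (0 : ℝ)..t, (K' s (F s) + K s (f s)) = K t (F t) - K 0 c := by
  have hKc : Continuous K := continuous_iff_continuousAt.2 fun s ↦ (hK s).continuousAt
  have hFc : ContinuousOn F (Set.uIcc 0 t) := by
    rw [Set.uIcc_of_le ht]
    have : ContinuousOn (fun s ↦ c + ∫ r in (0 : ℝ)..s, f r) (Set.uIcc 0 t) :=
      continuousOn_const.add (intervalIntegral.continuousOn_primitive_interval' hf (by simp))
    rw [Set.uIcc_of_le ht] at this
    exact this.congr hF
  have hint : IntervalIntegrable (fun s ↦ K' s (F s) + K s (f s)) volume 0 t :=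
    (intervalIntegrable_clm_apply hK' hFc.intervalIntegrable).add
      (intervalIntegrable_clm_apply hKc hf)
  have hexp : ∀ (T : (Fin n → ℝ) →L[ℝ] (Fin n → ℝ)) (x : Fin n → ℝ) (i : Fin n),
      T x i = ∑ j, T (Pi.single j 1) i * x j := by
    intro T x i
    rw [clm_pi_apply_eq_sum]
    simp [mul_comm]
  have hfj : ∀ j, IntervalIntegrable (fun s ↦ f s j) volume 0 t := fun j ↦
    ⟨hf.1.eval j, hf.2.eval j⟩
  have hk : ∀ i j s, HasDerivAt (fun s ↦ K s (Pi.single j 1) i) (K' s (Pi.single j 1) i) s :=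
    fun i j s ↦ hasDerivAt_pi.1
      (by simpa using (hK s).clm_apply (hasDerivAt_const s (Pi.single j (1 : ℝ)))) i
  have hk' : ∀ i j, Continuous fun s ↦ K' s (Pi.single j 1) i := fun i j ↦
    (continuous_apply i).comp (hK'.clm_apply continuous_const)
  have hFj : ∀ j, ∀ s ∈ Set.Icc 0 t, F s j = c j + ∫ r in (0 : ℝ)..s, f r j := by
    intro j s hs
    have hfs : IntervalIntegrable f volume 0 s := hf.mono_set (by
      rw [Set.uIcc_of_le hs.1, Set.uIcc_of_le ht]; exact Set.Icc_subset_Icc_right hs.2)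
    rw [hF s hs, Pi.add_apply]
    congr 1
    exact ((ContinuousLinearMap.proj (R := ℝ) (φ := fun _ : Fin n ↦ ℝ) j
      ).intervalIntegral_comp_comm hfs).symm
  ext i
  have hi := (ContinuousLinearMap.proj (R := ℝ) (φ := fun _ : Fin n ↦ ℝ) i
      ).intervalIntegral_comp_comm hint
  simp only [ContinuousLinearMap.proj_apply] at hi
  rw [← hi, Pi.sub_apply, hexp (K t), hexp (K 0), ← Finset.sum_sub_distrib]
  rw [← Finset.sum_congr rfl fun j _ ↦
    integral_mul_by_parts ht (hk i j) (hk' i j) (hfj j) (hFj j)]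
  rw [← intervalIntegral.integral_finsetSum]
  · refine intervalIntegral.integral_congr fun s _ ↦ ?_
    simp only [Pi.add_apply]
    rw [hexp (K' s), hexp (K s), ← Finset.sum_add_distrib]
  · intro j _
    have hFcj : ContinuousOn (fun s ↦ F s j) (Set.uIcc 0 t) :=
      (continuous_apply j).comp_continuousOn hFc
    exact ((hk' i j).continuousOn.mul hFcj).intervalIntegrable.add
      ((hfj j).continuousOn_mul (hKc.clm_apply continuous_const |> (continuous_apply i).comp
        |>.continuousOn))

/-! ### Input response sets. -/

/-- The states `∫₀ᵗ exp (s A) B u(s) ds` for measurable controls `u` with values in `U`. -/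
def inputResponses {n m : ℕ} (A : (Fin n → ℝ) →L[ℝ] (Fin n → ℝ))
    (B : (Fin m → ℝ) →L[ℝ] (Fin n → ℝ)) (U : Set (Fin m → ℝ)) (t : ℝ) : Set (Fin n → ℝ) :=
  {z | ∃ u : ℝ → Fin m → ℝ, Measurable u ∧ (∀ s, u s ∈ U) ∧
    ∫ s in (0 : ℝ)..t, flow A s (B (u s)) = z}

section InputResponses

variable {n m : ℕ} {A : (Fin n → ℝ) →L[ℝ] (Fin n → ℝ)} {B : (Fin m → ℝ) →L[ℝ] (Fin n → ℝ)}
  {U : Set (Fin m → ℝ)}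

theorem intervalIntegrable_of_forall_mem {u : ℝ → Fin m → ℝ} (hU : Bornology.IsBounded U)
    (hu : Measurable u) (huU : ∀ s, u s ∈ U) (a b : ℝ) : IntervalIntegrable u volume a b := by
  obtain ⟨C, hC⟩ := hU.exists_norm_le
  exact intervalIntegrable_const.mono_fun (g := u) (f := fun _ ↦ C) hu.aestronglyMeasurable
    (Filter.Eventually.of_forall fun s ↦ (hC _ (huU s)).trans (le_abs_self C))

theorem intervalIntegrable_flow_control (A : (Fin n → ℝ) →L[ℝ] (Fin n → ℝ))
    (B : (Fin m → ℝ) →L[ℝ] (Fin n → ℝ)) {u : ℝ → Fin m → ℝ} {a b : ℝ}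
    (hu : IntervalIntegrable u volume a b) :
    IntervalIntegrable (fun s ↦ flow A s (B (u s))) volume a b :=
  intervalIntegrable_clm_apply (K := fun s ↦ (flow A s).comp B)
    ((continuous_flow A).clm_comp continuous_const) hu

theorem convex_inputResponses (hU : Bornology.IsBounded U) (hc : Convex ℝ U) (t : ℝ) :
    Convex ℝ (inputResponses A B U t) := by
  rintro _ ⟨u, hu, huU, rfl⟩ _ ⟨v, hv, hvU, rfl⟩ a b ha hb hab
  refine ⟨fun s ↦ a • u s + b • v s, (hu.const_smul a).add (hv.const_smul b),
    fun s ↦ hc (huU s) (hvU s) ha hb hab, ?_⟩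
  have h1 := intervalIntegrable_flow_control A B (intervalIntegrable_of_forall_mem hU hu huU 0 t)
  have h2 := intervalIntegrable_flow_control A B (intervalIntegrable_of_forall_mem hU hv hvU 0 t)
  simp only [map_add, map_smul]
  refine (intervalIntegral.integral_add (h1.smul a) (h2.smul b)).trans ?_
  simp only [Pi.smul_apply, intervalIntegral.integral_smul]

theorem zero_mem_inputResponses (h0 : 0 ∈ U) (t : ℝ) : 0 ∈ inputResponses A B U t :=
  ⟨fun _ ↦ 0, measurable_const, fun _ ↦ h0, by simp⟩

/-- The integration variable is the time remaining. Thus `v` acts first and produces `y`, which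
drifts for time `t` while `u` adds `x`. -/
theorem add_mem_inputResponses (hU : Bornology.IsBounded U) {s t : ℝ} (hs : 0 ≤ s) (ht : 0 ≤ t)
    {x y : Fin n → ℝ} (hx : x ∈ inputResponses A B U t) (hy : y ∈ inputResponses A B U s) :
    x + flow A t y ∈ inputResponses A B U (t + s) := by
  obtain ⟨u, hu, huU, rfl⟩ := hx
  obtain ⟨v, hv, hvU, rfl⟩ := hy
  set w : ℝ → Fin m → ℝ := fun r ↦ if r ≤ t then u r else v (r - t) with hw
  have hwm : Measurable w :=
    Measurable.ite measurableSet_Iic hu (hv.comp (measurable_id.sub_const t))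
  have hwU : ∀ r, w r ∈ U := by
    intro r
    simp only [hw]
    split_ifs
    exacts [huU _, hvU _]
  refine ⟨w, hwm, hwU, ?_⟩
  have hwi := fun a b ↦
    intervalIntegrable_flow_control A B (intervalIntegrable_of_forall_mem hU hwm hwU a b)
  have hvi := fun a b ↦
    intervalIntegrable_flow_control A B (intervalIntegrable_of_forall_mem hU hv hvU a b)
  rw [← intervalIntegral.integral_add_adjacent_intervals (hwi 0 t) (hwi t (t + s))]
  congr 1
  · refine intervalIntegral.integral_congr fun r hr ↦ ?_
    rw [Set.uIcc_of_le ht] at hr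
    simp [hw, hr.2]
  · have h1 : ∫ r in t..t + s, flow A r (B (w r)) =
        ∫ r in t..t + s, flow A ((r - t) + t) (B (v (r - t))) := by
      refine intervalIntegral.integral_congr_ae (Filter.Eventually.of_forall fun r hr ↦ ?_)
      rw [Set.uIoc_of_le (by linarith)] at hr
      simp [hw, hr.1.not_ge]
    rw [h1, intervalIntegral.integral_comp_sub_right (fun r ↦ flow A (r + t) (B (v r))),
      ← (flow A t).intervalIntegral_comp_comm (hvi 0 s)]
    simp [add_comm, flow_add_apply]

theorem inputResponses_mono (hU : Bornology.IsBounded U) (h0 : 0 ∈ U) {s t : ℝ} (hs : 0 ≤ s)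
    (hst : s ≤ t) : inputResponses A B U s ⊆ inputResponses A B U t := by
  intro x hx
  have h := add_mem_inputResponses hU (sub_nonneg.2 hst) hs hx
    (zero_mem_inputResponses (A := A) (B := B) h0 (t - s))
  simpa using h

/-- The substitution `s ↦ t - s` turns `exp (tA) ∫ exp (-sA) B u(s)` into `∫ exp (sA) B u(t - s)`.
-/
theorem flow_mem_inputResponses {t : ℝ} {x : Fin n → ℝ} (hU : Bornology.IsBounded U)
    (hx : x ∈ inputResponses (-A) B U t) : flow A t x ∈ inputResponses A B U t := by
  obtain ⟨u, hu, huU, rfl⟩ := hx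
  refine ⟨fun s ↦ u (t - s), hu.comp (measurable_const.sub measurable_id), fun s ↦ huU _, ?_⟩
  rw [← (flow A t).intervalIntegral_comp_comm (intervalIntegrable_flow_control (-A) B
    (intervalIntegrable_of_forall_mem hU hu huU 0 t))]
  have h := intervalIntegral.integral_comp_sub_left (a := 0) (b := t)
    (fun s ↦ flow A t (flow (-A) s (B (u s)))) t
  simp only [sub_self, sub_zero] at h
  rw [← h]
  simp [flow_neg_left, ← flow_add_apply]

theorem inputResponses_neg_subset {t : ℝ} {z : Fin n → ℝ} (hU : Bornology.IsBounded U)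
    (hz : z ∈ inputResponses A B U t) : flow A (-t) z ∈ inputResponses (-A) B U t := by
  rw [← flow_neg_left]
  exact flow_mem_inputResponses hU (by rwa [neg_neg])

end InputResponses

/-! ### Feasible controls and variation of constants. -/

theorem IsFeasibleControl.exists_measurable {m : ℕ} {U : Set (Fin m → ℝ)} {t : ℝ}
    {u : ℝ → Fin m → ℝ} (hu : IsFeasibleControl U t u) (hUc : IsClosed U) (h0 : 0 ∈ U) :
    ∃ v : ℝ → Fin m → ℝ, Measurable v ∧ (∀ s, v s ∈ U) ∧
      ∀ᵐ s ∂(volume.restrict (Set.Icc 0 t)), v s = u s := by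
  classical
  obtain ⟨hui, huU⟩ := hu
  have hm := hui.aestronglyMeasurable
  set w := hm.mk u
  have hwm : Measurable w := hm.stronglyMeasurable_mk.measurable
  -- The value `0 ∈ U` replaces `w s` outside `U`; this changes the control only on a null set.
  refine ⟨fun s ↦ if w s ∈ U then w s else 0,
    Measurable.ite (hwm hUc.measurableSet) hwm measurable_const, fun s ↦ ?_, ?_⟩
  · dsimp only
    split_ifs with h
    exacts [h, h0]
  · filter_upwards [huU, hm.ae_eq_mk] with s h1 h2
    rw [← show u s = w s from h2, if_pos h1]

theorem isFeasibleControl_of_forall_mem {m : ℕ} {U : Set (Fin m → ℝ)} {t : ℝ} (ht : 0 ≤ t)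
    {u : ℝ → Fin m → ℝ} (hU : Bornology.IsBounded U) (hu : Measurable u) (huU : ∀ s, u s ∈ U) :
    IsFeasibleControl U t u :=
  ⟨(intervalIntegrable_iff_integrableOn_Icc_of_le ht).1
    (intervalIntegrable_of_forall_mem hU hu huU 0 t), Filter.Eventually.of_forall huU⟩

/-- The continuous linear map `x ↦ M x` of a real matrix `M`. -/
noncomputable def mulVecCLM {n m : ℕ} (M : Matrix (Fin n) (Fin m) ℝ) :
    (Fin m → ℝ) →L[ℝ] (Fin n → ℝ) :=
  LinearMap.toContinuousLinearMap (Matrix.toLin' M)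

@[simp]
theorem mulVecCLM_apply {n m : ℕ} (M : Matrix (Fin n) (Fin m) ℝ) (x : Fin m → ℝ) :
    mulVecCLM M x = M *ᵥ x := by
  simp [mulVecCLM]

theorem IsStateResponse.flow_neg_apply {n m : ℕ} {A : Matrix (Fin n) (Fin n) ℝ}
    {B : Matrix (Fin n) (Fin m) ℝ} {x₀ : Fin n → ℝ} {u : ℝ → Fin m → ℝ} {t : ℝ}
    {x : ℝ → Fin n → ℝ} (ht : 0 ≤ t) (hx : IsStateResponse A B x₀ u t x)
    (hu : IntegrableOn u (Set.Icc 0 t)) :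
    flow (-mulVecCLM A) t (x t) =
      x₀ + ∫ s in (0 : ℝ)..t, flow (-mulVecCLM A) s (mulVecCLM B (u s)) := by
  obtain ⟨hxc, hxe⟩ := hx
  have hui : IntervalIntegrable u volume 0 t :=
    (intervalIntegrable_iff_integrableOn_Icc_of_le ht).2 hu
  have hxi : IntervalIntegrable x volume 0 t :=
    ContinuousOn.intervalIntegrable (by rwa [Set.uIcc_of_le ht])
  have hf : IntervalIntegrable (fun τ ↦ mulVecCLM A (x τ) + mulVecCLM B (u τ)) volume 0 t :=
    (intervalIntegrable_clm_apply continuous_const hxi).add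
      (intervalIntegrable_clm_apply continuous_const hui)
  have h := integral_clm_apply_by_parts ht (hasDerivAt_flow (-mulVecCLM A))
    ((continuous_flow _).mul continuous_const) hf (F := x) (c := x₀) (fun s hs ↦ by
      simpa using hxe s hs)
  rw [flow_zero, one_apply_eq_self] at h
  rw [← sub_eq_iff_eq_add', ← h]
  refine intervalIntegral.integral_congr fun s _ ↦ ?_
  simp

theorem isStateResponse_flow {n m : ℕ} {A : Matrix (Fin n) (Fin n) ℝ}
    {B : Matrix (Fin n) (Fin m) ℝ} (x₀ : Fin n → ℝ) {u : ℝ → Fin m → ℝ} {t : ℝ} (ht : 0 ≤ t)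
    (hu : IntegrableOn u (Set.Icc 0 t)) :
    IsStateResponse A B x₀ u t fun s ↦ flow (mulVecCLM A) s
      (x₀ + ∫ r in (0 : ℝ)..s, flow (-mulVecCLM A) r (mulVecCLM B (u r))) := by
  have hui : IntervalIntegrable u volume 0 t :=
    (intervalIntegrable_iff_integrableOn_Icc_of_le ht).2 hu
  have hf := intervalIntegrable_flow_control (-mulVecCLM A) (mulVecCLM B) hui
  set F : ℝ → Fin n → ℝ := fun s ↦
    x₀ + ∫ r in (0 : ℝ)..s, flow (-mulVecCLM A) r (mulVecCLM B (u r))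
  have hFc : ContinuousOn F (Set.Icc 0 t) := by
    rw [← Set.uIcc_of_le ht]
    exact continuousOn_const.add (intervalIntegral.continuousOn_primitive_interval' hf (by simp))
  refine ⟨(continuous_flow _).continuousOn.clm_apply hFc, fun s hs ↦ ?_⟩
  have hfs : IntervalIntegrable (fun s ↦ flow (-mulVecCLM A) s (mulVecCLM B (u s))) volume 0 s :=
    hf.mono_set (by
      rw [Set.uIcc_of_le hs.1, Set.uIcc_of_le ht]; exact Set.Icc_subset_Icc_right hs.2)
  have h := integral_clm_apply_by_parts hs.1 (hasDerivAt_flow (mulVecCLM A))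
    ((continuous_flow _).mul continuous_const) hfs (F := F) (c := x₀) (fun _ _ ↦ rfl)
  rw [flow_zero, one_apply_eq_self] at h
  change flow (mulVecCLM A) s (F s) = _
  rw [← sub_eq_iff_eq_add', ← h]
  refine intervalIntegral.integral_congr fun r _ ↦ ?_
  simp [F, flow_neg_left, flow_apply_comm, ← mulVecCLM_apply]

theorem mem_reachableAt_iff {n m : ℕ} {A : Matrix (Fin n) (Fin n) ℝ}
    {B : Matrix (Fin n) (Fin m) ℝ} {U : Set (Fin m → ℝ)} (hU : IsCompact U) (h0 : 0 ∈ U)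
    {t : ℝ} (ht : 0 ≤ t) (x₀ z : Fin n → ℝ) :
    z ∈ reachableAt A B U t x₀ ↔
      z - flow (mulVecCLM A) t x₀ ∈ inputResponses (mulVecCLM A) (mulVecCLM B) U t := by
  constructor
  · rintro ⟨u, hu, x, hx, rfl⟩
    have h := hx.flow_neg_apply ht hu.1
    obtain ⟨v, hv, hvU, hvu⟩ := hu.exists_measurable hU.isClosed h0
    have hmem : (∫ s in (0 : ℝ)..t, flow (-mulVecCLM A) s (mulVecCLM B (u s))) ∈
        inputResponses (-mulVecCLM A) (mulVecCLM B) U t := by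
      refine ⟨v, hv, hvU, ?_⟩
      refine intervalIntegral.integral_congr_ae ?_
      rw [ae_restrict_iff' measurableSet_Icc] at hvu
      filter_upwards [hvu] with s hs hs'
      rw [Set.uIoc_of_le ht] at hs'
      rw [hs ⟨hs'.1.le, hs'.2⟩]
    have h2 := flow_mem_inputResponses hU.isBounded hmem
    rw [eq_sub_iff_add_eq'.2 h.symm, map_sub, flow_neg_left, flow_apply_flow_neg] at h2
    exact h2
  · intro hz
    obtain ⟨u, hu, huU, he⟩ := inputResponses_neg_subset hU.isBounded hz
    have hfeas := isFeasibleControl_of_forall_mem ht hU.isBounded hu huU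
    refine ⟨u, hfeas, _, isStateResponse_flow x₀ ht hfeas.1, ?_⟩
    simp only [he]
    simp

/-! ### Functionals along orbits and the roots of an annihilating polynomial. -/

/-- Precomposition with `A` is `ℂ`-linear on `ℂ`-valued functionals, so a real polynomial in `A` can
be split into linear factors there without complexifying `V`. -/
theorem aeval_lcomp_apply {V : Type*} [AddCommGroup V] [Module ℝ V] (A : V →ₗ[ℝ] V)
    (p : Polynomial ℝ) (φ : V →ₗ[ℝ] ℂ) (x : V) :
    Polynomial.aeval (LinearMap.lcomp ℂ ℂ A) (p.map (algebraMap ℝ ℂ)) φ x =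
      φ (Polynomial.aeval A p x) := by
  have hpow : ∀ k : ℕ, ∀ φ : V →ₗ[ℝ] ℂ, ((LinearMap.lcomp ℂ ℂ A) ^ k) φ x = φ ((A ^ k) x) := by
    intro k
    induction k with
    | zero => simp
    | succ k ih =>
      intro φ
      rw [pow_succ, Module.End.mul_apply, ih, LinearMap.lcomp_apply, pow_succ', Module.End.mul_apply]
  induction p using Polynomial.induction_on' with
  | add p q hp hq =>
    rw [Polynomial.map_add, map_add, map_add, LinearMap.add_apply, LinearMap.add_apply, hp, hq,
      LinearMap.add_apply, map_add]
  | monomial k a =>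
    rw [Polynomial.map_monomial, Polynomial.aeval_monomial, Polynomial.aeval_monomial]
    simp [hpow, Algebra.algebraMap_eq_smul_one]

theorem aeval_lcomp_prod_roots_apply {V : Type*} [AddCommGroup V] [Module ℝ V] {p : Polynomial ℝ} (hp : p.Monic) (A : V →ₗ[ℝ] V)
    (φ : V →ₗ[ℝ] ℂ) (x : V) :
    Polynomial.aeval (LinearMap.lcomp ℂ ℂ A)
      ((p.map (algebraMap ℝ ℂ)).roots.map fun μ ↦ Polynomial.X - Polynomial.C μ).prod φ x =
      φ (Polynomial.aeval A p x) := by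
  rw [← (IsAlgClosed.splits (p.map (algebraMap ℝ ℂ))).eq_prod_roots_of_monic (hp.map _),
    aeval_lcomp_apply]

theorem aeval_eq_zero_of_mem_roots_map {p : Polynomial ℝ} {μ : ℂ}
    (hμ : μ ∈ (p.map (algebraMap ℝ ℂ)).roots) : Polynomial.aeval μ p = 0 := by
  have h := (Polynomial.mem_roots'.1 hμ).2
  rwa [Polynomial.IsRoot.def, Polynomial.eval_map_algebraMap] at h

section Functionals

variable {V : Type*} [NormedAddCommGroup V] [NormedSpace ℝ V] [FiniteDimensional ℝ V]

/-- The integrating factor trades `φ` for `φ ∘ A - μ φ`, which removes one root in the two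
inductions that follow. -/
theorem hasDerivAt_cexp_mul_flow (A : V →L[ℝ] V) (φ : V →ₗ[ℝ] ℂ) (x : V) (μ : ℂ) (t : ℝ) :
    HasDerivAt (fun s : ℝ ↦ Complex.exp (-μ * s) * φ (flow A s x))
      (Complex.exp (-μ * t) * (LinearMap.lcomp ℂ ℂ (A : V →ₗ[ℝ] V) φ - μ • φ) (flow A t x)) t := by
  have : CompleteSpace V := FiniteDimensional.complete ℝ V
  have h1 : HasDerivAt (fun s : ℝ ↦ φ (flow A s x)) (φ (A (flow A t x))) t := by
    rw [← flow_apply_comm]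
    exact (LinearMap.toContinuousLinearMap φ).hasFDerivAt.comp_hasDerivAt t
      (hasDerivAt_flow_apply A x t)
  have h2 : HasDerivAt (fun s : ℝ ↦ Complex.exp (-μ * s)) (Complex.exp (-μ * t) * (-μ)) t := by
    simpa using ((hasDerivAt_id t).ofReal_comp.const_mul (-μ)).cexp
  convert! h2.mul h1 using 1
  simp
  ring

theorem apply_flow_of_eigenfunctional (A : V →L[ℝ] V) {N : Submodule ℝ V}
    (hN : ∀ x ∈ N, A x ∈ N) {φ : V →ₗ[ℝ] ℂ} {μ : ℂ} (hφ : ∀ x ∈ N, φ (A x) = μ * φ x) (t : ℝ)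
    {x : V} (hx : x ∈ N) : φ (flow A t x) = Complex.exp (μ * t) * φ x := by
  have : CompleteSpace V := FiniteDimensional.complete ℝ V
  have hd : ∀ s : ℝ, HasDerivAt (fun s : ℝ ↦ Complex.exp (-μ * s) * φ (flow A s x)) 0 s := by
    intro s
    convert! hasDerivAt_cexp_mul_flow A φ x μ s using 1
    simp [hφ _ (flow_mem N.closed_of_finiteDimensional hN s hx)]
  have h := is_const_of_deriv_eq_zero (fun s ↦ (hd s).differentiableAt) (fun s ↦ (hd s).deriv) t 0
  simp only [Complex.ofReal_zero, mul_zero, Complex.exp_zero, one_mul, flow_zero,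
    one_apply_eq_self] at h
  rw [← h, ← mul_assoc, ← Complex.exp_add]
  simp

/-- By induction `φ ∘ A - μ φ` vanishes on `N`, so `φ` is an eigenfunctional there and `‖φ (exp (jA)
x)‖ = exp (j Re μ) ‖φ x‖ ≥ ‖φ x‖`, while the left side tends to `0`. -/
theorem functional_eq_zero_of_tendsto_flow (A : V →L[ℝ] V) {N : Submodule ℝ V}
    (hN : ∀ x ∈ N, A x ∈ N) (s : Multiset ℂ) (hs : ∀ μ ∈ s, 0 ≤ μ.re) :
    ∀ φ : V →ₗ[ℝ] ℂ,
      (∀ x ∈ N, Filter.Tendsto (fun j : ℕ ↦ φ (flow A j x)) Filter.atTop (nhds 0)) →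
      (∀ x ∈ N, Polynomial.aeval (LinearMap.lcomp ℂ ℂ (A : V →ₗ[ℝ] V))
        (s.map fun μ ↦ Polynomial.X - Polynomial.C μ).prod φ x = 0) →
      ∀ x ∈ N, φ x = 0 := by
  have : CompleteSpace V := FiniteDimensional.complete ℝ V
  induction s using Multiset.induction_on with
  | empty =>
    intro φ _ h x hx
    simpa using h x hx
  | cons μ s ih =>
    intro φ hlim h x hx
    have hψ := ih (fun ν hν ↦ hs ν (Multiset.mem_cons_of_mem hν))
      (LinearMap.lcomp ℂ ℂ (A : V →ₗ[ℝ] V) φ - μ • φ) (fun y hy ↦ by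
        have h1 := hlim (A y) (hN y hy)
        simp only [flow_apply_comm] at h1
        simpa using h1.sub ((hlim y hy).const_mul μ)) (fun y hy ↦ by
        have h1 := h y hy
        rw [Multiset.map_cons, Multiset.prod_cons, mul_comm, map_mul, Module.End.mul_apply] at h1
        rw [← h1]
        simp)
    have hev : ∀ y ∈ N, φ (A y) = μ * φ y := fun y hy ↦ by
      simpa [sub_eq_zero] using hψ y hy
    have hle : ∀ j : ℕ, ‖φ x‖ ≤ ‖φ (flow A j x)‖ := by
      intro j
      rw [apply_flow_of_eigenfunctional A hN hev j hx, norm_mul, Complex.norm_exp]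
      refine le_mul_of_one_le_left (norm_nonneg _) (Real.one_le_exp ?_)
      have := mul_nonneg (hs μ (Multiset.mem_cons_self μ s)) (Nat.cast_nonneg' (α := ℝ) j)
      simpa using this
    have h0 : ‖φ x‖ ≤ 0 := ge_of_tendsto' (by simpa using (hlim x hx).norm) hle
    simpa using h0

theorem exists_norm_functional_flow_le (A : V →L[ℝ] V) {N : Submodule ℝ V}
    (hN : ∀ x ∈ N, A x ∈ N) {ω : ℝ} (s : Multiset ℂ)
    (hs : ∀ μ ∈ s, μ.re < -ω) :
    ∀ φ : V →ₗ[ℝ] ℂ,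
      (∀ x ∈ N, Polynomial.aeval (LinearMap.lcomp ℂ ℂ (A : V →ₗ[ℝ] V))
        (s.map fun μ ↦ Polynomial.X - Polynomial.C μ).prod φ x = 0) →
      ∀ x ∈ N, ∃ C : ℝ, 0 ≤ C ∧ ∀ t : ℝ, 0 ≤ t → ‖φ (flow A t x)‖ ≤ C * Real.exp (-ω * t) := by
  have : CompleteSpace V := FiniteDimensional.complete ℝ V
  induction s using Multiset.induction_on with
  | empty =>
    intro φ h x hx
    refine ⟨0, le_rfl, fun t _ ↦ ?_⟩
    simpa using h _ (flow_mem N.closed_of_finiteDimensional hN t hx)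
  | cons μ s ih =>
    intro φ h x hx
    obtain ⟨C, hC0, hC⟩ := ih (fun ν hν ↦ hs ν (Multiset.mem_cons_of_mem hν))
      (LinearMap.lcomp ℂ ℂ (A : V →ₗ[ℝ] V) φ - μ • φ) (fun y hy ↦ by
        have h1 := h y hy
        rw [Multiset.map_cons, Multiset.prod_cons, mul_comm, map_mul, Module.End.mul_apply] at h1
        rw [← h1]
        simp) x hx
    -- The strict gap `δ` absorbs the polynomial factors of Jordan blocks: integrating `C exp (δ s)`
    -- costs only a factor `1 / δ`.
    set δ : ℝ := -μ.re - ω with hδ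
    have hδ0 : 0 < δ := by linarith [hs μ (Multiset.mem_cons_self μ s)]
    refine ⟨‖φ x‖ + C / δ, by positivity, fun t ht ↦ ?_⟩
    have hz := hasDerivAt_cexp_mul_flow A φ x μ
    have hb := image_norm_le_of_norm_deriv_right_le_deriv_boundary
      (f := fun s : ℝ ↦ Complex.exp (-μ * s) * φ (flow A s x)) (a := 0) (b := t)
      (fun s _ ↦ (hz s).continuousAt.continuousWithinAt) (fun s _ ↦ (hz s).hasDerivWithinAt)
      (B := fun s ↦ ‖φ x‖ + C / δ * (Real.exp (δ * s) - 1))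
      (B' := fun s ↦ C * Real.exp (δ * s)) (by simp) (fun s ↦ by
        have h1 := (((((hasDerivAt_id s).const_mul δ).exp).sub_const 1).const_mul
          (C / δ)).const_add ‖φ x‖
        convert! h1 using 1
        simp only [id_eq, mul_one]
        field_simp) (fun s hs ↦ by
        rw [norm_mul, Complex.norm_exp]
        refine (mul_le_mul_of_nonneg_left (hC s hs.1) (Real.exp_nonneg _)).trans_eq ?_
        rw [mul_left_comm, ← Real.exp_add]
        congr 2
        simp [hδ]
        ring) (show t ∈ Set.Icc 0 t from ⟨ht, le_rfl⟩)
    rw [norm_mul, Complex.norm_exp] at hb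
    have h3 : Real.exp (-μ * t : ℂ).re * ‖φ (flow A t x)‖ ≤
        (‖φ x‖ + C / δ) * Real.exp (δ * t) := by
      refine hb.trans ?_
      have h4 : 1 ≤ Real.exp (δ * t) := Real.one_le_exp (by positivity)
      have h5 : 0 ≤ C / δ := by positivity
      nlinarith [norm_nonneg (φ x), mul_nonneg (norm_nonneg (φ x)) (sub_nonneg.2 h4)]
    have h6 := mul_le_mul_of_nonneg_left h3 (Real.exp_nonneg (μ.re * t))
    rw [← mul_assoc, ← Real.exp_add, mul_left_comm, ← Real.exp_add] at h6
    have e1 : μ.re * t + (-μ * t : ℂ).re = 0 := by simp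
    have e2 : μ.re * t + δ * t = -ω * t := by rw [hδ]; ring
    rwa [e1, e2, Real.exp_zero, one_mul] at h6

theorem eq_zero_of_tendsto_flow (A : V →L[ℝ] V) {N : Submodule ℝ V}
    (hN : ∀ x ∈ N, A x ∈ N) {p : Polynomial ℝ} (hp : p.Monic)
    (hroots : ∀ z : ℂ, Polynomial.aeval z p = 0 → 0 ≤ z.re)
    (hpN : ∀ x ∈ N, Polynomial.aeval (A : V →ₗ[ℝ] V) p x = 0) (η : V →ₗ[ℝ] ℝ)
    (hη : ∀ x ∈ N, Filter.Tendsto (fun j : ℕ ↦ η (flow A j x)) Filter.atTop (nhds 0)) :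
    ∀ x ∈ N, η x = 0 := by
  intro x hx
  have h := functional_eq_zero_of_tendsto_flow A hN (p.map (algebraMap ℝ ℂ)).roots
    (fun μ hμ ↦ hroots μ (aeval_eq_zero_of_mem_roots_map hμ))
    (Complex.ofRealCLM.toLinearMap.comp η) (fun y hy ↦ by
      simpa [Function.comp_def] using (Complex.continuous_ofReal.tendsto 0).comp (hη y hy)) (fun y hy ↦ by
      rw [aeval_lcomp_prod_roots_apply hp, hpN y hy, map_zero]) x hx
  simpa using h

end Functionals

theorem exists_norm_flow_le {n : ℕ} (A : (Fin n → ℝ) →L[ℝ] (Fin n → ℝ))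
    {N : Submodule ℝ (Fin n → ℝ)} (hN : ∀ x ∈ N, A x ∈ N) {p : Polynomial ℝ} (hp : p.Monic)
    (hroots : ∀ z : ℂ, Polynomial.aeval z p = 0 → z.re < 0)
    (hpN : ∀ x ∈ N, Polynomial.aeval (A : (Fin n → ℝ) →ₗ[ℝ] (Fin n → ℝ)) p x = 0) :
    ∃ ω : ℝ, 0 < ω ∧ ∀ x ∈ N, ∃ C : ℝ, 0 ≤ C ∧
      ∀ t : ℝ, 0 ≤ t → ‖flow A t x‖ ≤ C * Real.exp (-ω * t) := by
  obtain ⟨ω, hω0, hω⟩ : ∃ ω : ℝ, 0 < ω ∧ ∀ μ ∈ (p.map (algebraMap ℝ ℂ)).roots, μ.re < -ω := by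
    have hneg : ∀ μ ∈ (p.map (algebraMap ℝ ℂ)).roots, μ.re < 0 := fun μ hμ ↦
      hroots μ (aeval_eq_zero_of_mem_roots_map hμ)
    generalize (p.map (algebraMap ℝ ℂ)).roots = s at hneg
    induction s using Multiset.induction_on with
    | empty => exact ⟨1, one_pos, by simp⟩
    | cons μ s ih =>
      obtain ⟨ω, h0, h⟩ := ih fun ν hν ↦ hneg ν (Multiset.mem_cons_of_mem hν)
      have hμ := hneg μ (Multiset.mem_cons_self μ s)
      -- Halving keeps the inequality `μ.re < -ω` strict.
      refine ⟨min ω (-μ.re / 2), lt_min h0 (by linarith), fun ν hν ↦ ?_⟩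
      rcases Multiset.mem_cons.1 hν with rfl | hν
      · linarith [min_le_right ω (-ν.re / 2)]
      · linarith [min_le_left ω (-μ.re / 2), h ν hν]
  refine ⟨ω, hω0, fun x hx ↦ ?_⟩
  have hi := fun i : Fin n ↦ exists_norm_functional_flow_le A hN _ hω
    (Complex.ofRealCLM.toLinearMap.comp (LinearMap.proj i)) (fun y hy ↦ by
      rw [aeval_lcomp_prod_roots_apply hp, hpN y hy, map_zero]) x hx
  choose C hC0 hC using hi
  have hsum : 0 ≤ ∑ i, C i := Finset.sum_nonneg fun i _ ↦ hC0 i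
  refine ⟨∑ i, C i, hsum, fun t ht ↦ ?_⟩
  refine (pi_norm_le_iff_of_nonneg (by positivity)).2 fun i ↦ ?_
  have h1 := hC i t ht
  have h2 : C i ≤ ∑ i, C i := Finset.single_le_sum (fun i _ ↦ hC0 i) (Finset.mem_univ i)
  have h3 : ‖flow A t x i‖ ≤ C i * Real.exp (-ω * t) := by simpa using h1
  exact h3.trans (mul_le_mul_of_nonneg_right h2 (Real.exp_nonneg _))

/-! ### Complex spectrum and annihilating real polynomials. -/

theorem mem_complexSpectrum_iff {V : Type*} [AddCommGroup V] [Module ℝ V] [Module.Finite ℝ V]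
    (T : V →ₗ[ℝ] V) (z : ℂ) : z ∈ complexSpectrum T ↔ Polynomial.aeval z T.charpoly = 0 := by
  rw [complexSpectrum, Module.End.mem_spectrum_iff_isRoot_charpoly, LinearMap.charpoly_baseChange,
    Polynomial.IsRoot.def, Polynomial.eval_map_algebraMap]

theorem aeval_eq_zero_of_mem_complexSpectrum {V : Type*} [AddCommGroup V] [Module ℝ V]
    [Module.Finite ℝ V] {T : V →ₗ[ℝ] V} {p : Polynomial ℝ} (hp : Polynomial.aeval T p = 0) {z : ℂ}
    (hz : z ∈ complexSpectrum T) : Polynomial.aeval z p = 0 := by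
  have h : Polynomial.aeval (LinearMap.baseChange ℂ T) (p.map (algebraMap ℝ ℂ)) = 0 := by
    have h1 := Polynomial.aeval_algHom_apply (Module.End.baseChangeHom ℝ ℂ V) T p
    rw [hp, map_zero] at h1
    rw [Polynomial.aeval_map_algebraMap]
    exact h1
  have h2 := Module.End.isRoot_of_hasEigenvalue (Module.End.hasEigenvalue_iff_mem_spectrum.2 hz)
  have h3 := h2.dvd (minpoly.dvd ℂ _ h)
  rwa [Polynomial.IsRoot.def, Polynomial.eval_map_algebraMap] at h3

theorem coe_aeval_restrict_apply {V : Type*} [AddCommGroup V] [Module ℝ V] (T : V →ₗ[ℝ] V)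
    {N : Submodule ℝ V} (hN : ∀ x ∈ N, T x ∈ N) (p : Polynomial ℝ) (x : N) :
    (Polynomial.aeval (T.restrict hN) p x : V) = Polynomial.aeval T p x := by
  induction p using Polynomial.induction_on' with
  | add p q hp hq => simp [hp, hq]
  | monomial k a =>
    rw [Polynomial.aeval_monomial, Polynomial.aeval_monomial, Module.End.pow_restrict]
    simp [Algebra.algebraMap_eq_smul_one]

theorem aeval_charpoly_restrict_apply {V : Type*} [AddCommGroup V] [Module ℝ V]
    [Module.Finite ℝ V] (T : V →ₗ[ℝ] V)
    {N : Submodule ℝ V} (hN : ∀ x ∈ N, T x ∈ N) {x : V} (hx : x ∈ N) :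
    Polynomial.aeval T (T.restrict hN).charpoly x = 0 := by
  rw [← coe_aeval_restrict_apply T hN _ ⟨x, hx⟩, LinearMap.aeval_self_charpoly]
  simp

/-! ### Reachability from the origin. -/

section Reachability

variable {n m : ℕ} {A : (Fin n → ℝ) →L[ℝ] (Fin n → ℝ)} {B : (Fin m → ℝ) →L[ℝ] (Fin n → ℝ)}
  {U : Set (Fin m → ℝ)}

theorem inputResponses_subset_of_subset {U' : Set (Fin m → ℝ)} (h : U' ⊆ U) (t : ℝ) :
    inputResponses A B U' t ⊆ inputResponses A B U t := by
  rintro _ ⟨u, hu, huU, rfl⟩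
  exact ⟨u, hu, fun s ↦ h (huU s), rfl⟩

/-- Test with the control `h e_j`, `h = r g / (1 + g²)`, where `g` is the function to be killed: it
stays in the ball and makes the integrand `h g` nonnegative, positive wherever `g ≠ 0`. -/
theorem functional_flow_eq_zero (ψ : (Fin n → ℝ) →L[ℝ] ℝ) {r : ℝ} (hr : 0 < r)
    (hψ : ∀ x ∈ inputResponses A B (Metric.ball 0 r) 1, ψ x = 0) (j : Fin m) :
    ∀ s ∈ Set.Icc (0 : ℝ) 1, ψ (flow A s (B (Pi.single j 1))) = 0 := by
  set g : ℝ → ℝ := fun s ↦ ψ (flow A s (B (Pi.single j 1))) with hg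
  have hgc : Continuous g := ψ.continuous.comp (continuous_flow_apply A _)
  set h : ℝ → ℝ := fun s ↦ r * (g s / (1 + g s ^ 2)) with hh
  have hhc : Continuous h :=
    continuous_const.mul (hgc.div (by fun_prop) fun s ↦ by positivity)
  have hhb : ∀ s, |h s| < r := by
    intro s
    rw [hh, abs_mul, abs_of_pos hr, abs_div, abs_of_pos (by positivity : 0 < 1 + g s ^ 2)]
    have : |g s| / (1 + g s ^ 2) < 1 := by
      rw [div_lt_one (by positivity), ← sq_abs]
      nlinarith [sq_nonneg (|g s| - 1), abs_nonneg (g s)]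
    nlinarith
  have hmeas : Measurable fun s ↦ (Pi.single j (h s) : Fin m → ℝ) := by
    refine Continuous.measurable (continuous_pi fun i ↦ ?_)
    rcases eq_or_ne i j with rfl | hij
    · simpa using hhc
    · simpa [hij] using continuous_const
  have hball : ∀ s, (Pi.single j (h s) : Fin m → ℝ) ∈ Metric.ball 0 r := by
    intro s
    rw [mem_ball_zero_iff, Pi.norm_single]
    exact hhb s
  have h0 := hψ _ ⟨_, hmeas, hball, rfl⟩
  rw [← ψ.intervalIntegral_comp_comm (intervalIntegrable_flow_control A B
    (intervalIntegrable_of_forall_mem Metric.isBounded_ball hmeas hball 0 1))] at h0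
  have he : ∀ s, ψ (flow A s (B (Pi.single j (h s)))) = h s * g s := by
    intro s
    have : (Pi.single j (h s) : Fin m → ℝ) = h s • Pi.single j 1 := by
      rw [← Pi.single_smul, smul_eq_mul, mul_one]
    rw [this]
    simp [hg]
  simp only [he] at h0
  have hnn : ∀ s, 0 ≤ h s * g s := by
    intro s
    have : h s * g s = r * (g s ^ 2 / (1 + g s ^ 2)) := by rw [hh]; ring
    rw [this]
    positivity
  by_contra! hne
  obtain ⟨s, hs, hsne⟩ := hne
  have hpos := intervalIntegral.integral_pos one_pos (hhc.mul hgc).continuousOn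
    (fun x _ ↦ hnn x) ⟨s, hs, lt_of_le_of_ne (hnn s) (Ne.symm (mul_ne_zero ?_ hsne))⟩
  · exact hpos.ne' h0
  · exact mul_ne_zero hr.ne' (div_ne_zero hsne (by positivity))

/-- Repeated differentiation in `s` brings down powers of `A`. This needs interior times, hence
evaluation at `1 / 2`; invertibility of `exp (A / 2)` then transfers the conclusion to `ψ`. -/
theorem functional_eq_zero_of_controllable
    (hctrl : ∀ ψ : (Fin n → ℝ) →ₗ[ℝ] ℝ, (∀ (k : ℕ) (w : Fin m → ℝ), ψ ((A ^ k) (B w)) = 0) → ψ = 0)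
    (ψ : (Fin n → ℝ) →L[ℝ] ℝ)
    (hψ : ∀ j, ∀ s ∈ Set.Icc (0 : ℝ) 1, ψ (flow A s (B (Pi.single j 1))) = 0) : ψ = 0 := by
  have hk : ∀ (k : ℕ) (j : Fin m), ∀ s ∈ Set.Ioo (0 : ℝ) 1,
      ψ (flow A s ((A ^ k) (B (Pi.single j 1)))) = 0 := by
    intro k
    induction k with
    | zero => exact fun j s hs ↦ hψ j s ⟨hs.1.le, hs.2.le⟩
    | succ k ih =>
      intro j s hs
      have hd : HasDerivAt (fun r ↦ ψ (flow A r ((A ^ k) (B (Pi.single j 1)))))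
          (ψ (flow A s (A ((A ^ k) (B (Pi.single j 1)))))) s :=
        ψ.hasFDerivAt.comp_hasDerivAt s (hasDerivAt_flow_apply A _ s)
      have h0 : (fun r ↦ ψ (flow A r ((A ^ k) (B (Pi.single j 1))))) =ᶠ[nhds s] fun _ ↦ 0 := by
        filter_upwards [isOpen_Ioo.mem_nhds hs] with r hr using ih j r hr
      rw [pow_succ']
      exact hd.unique ((hasDerivAt_const s (0 : ℝ)).congr_of_eventuallyEq h0)
  have h1 := hctrl ((ψ.comp (flow A (1 / 2))).toLinearMap) fun k w ↦ by
    have hw := clm_pi_apply_eq_sum ((ψ.comp (flow A (1 / 2))).comp ((A ^ k).comp B)) w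
    simp only [ContinuousLinearMap.comp_apply] at hw
    simp only [ContinuousLinearMap.coe_coe, ContinuousLinearMap.comp_apply]
    rw [hw]
    exact Finset.sum_eq_zero fun j _ ↦ by rw [hk k j (1 / 2) (by norm_num), smul_zero]
  ext1 x
  have h2 := LinearMap.congr_fun h1 (flow A (-(1 / 2)) x)
  simpa only [ContinuousLinearMap.coe_coe, ContinuousLinearMap.comp_apply,
    flow_apply_flow_neg, LinearMap.zero_apply, zero_apply] using h2

/-- Shrinking `U` to a ball makes the response set symmetric as well as convex. It spans by
controllability, so it has an interior point `x`, and `0` is the midpoint of `x` and `-x`. -/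
theorem zero_mem_interior_inputResponses
    (hctrl : ∀ ψ : (Fin n → ℝ) →ₗ[ℝ] ℝ, (∀ (k : ℕ) (w : Fin m → ℝ), ψ ((A ^ k) (B w)) = 0) → ψ = 0)
    (hU0 : 0 ∈ interior U) : 0 ∈ interior (inputResponses A B U 1) := by
  obtain ⟨r, hr, hrU⟩ := Metric.mem_nhds_iff.1 (mem_interior_iff_mem_nhds.1 hU0)
  set C := inputResponses A B (Metric.ball 0 r) 1
  refine interior_mono (inputResponses_subset_of_subset hrU 1) ?_
  have hconv : Convex ℝ C := convex_inputResponses Metric.isBounded_ball (convex_ball 0 r) 1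
  have h0 : (0 : Fin n → ℝ) ∈ C := zero_mem_inputResponses (Metric.mem_ball_self hr) 1
  have hneg : ∀ x ∈ C, -x ∈ C := by
    rintro _ ⟨u, hu, huU, rfl⟩
    exact ⟨fun s ↦ -u s, hu.neg, fun s ↦ by simpa using huU s, by simp⟩
  have hspan : vectorSpan ℝ C = ⊤ := by
    by_contra hlt
    obtain ⟨ψ, hψ0, hψ⟩ := Submodule.exists_le_ker_of_lt_top _ (lt_top_iff_ne_top.2 hlt)
    refine hψ0 ?_
    have hz := functional_eq_zero_of_controllable hctrl (LinearMap.toContinuousLinearMap ψ)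
      fun j ↦ functional_flow_eq_zero _ hr (fun x hx ↦ by
        have h1 : x -ᵥ 0 ∈ vectorSpan ℝ C := vsub_mem_vectorSpan ℝ hx h0
        simpa using hψ h1) j
    simpa using hz
  obtain ⟨x, hx⟩ := hconv.interior_nonempty_iff_affineSpan_eq_top.2
    ((AffineSubspace.affineSpan_eq_top_iff_vectorSpan_eq_top_of_nonempty ℝ _ _ ⟨0, h0⟩).2 hspan)
  refine hconv.openSegment_interior_self_subset_interior hx (hneg x (interior_subset hx)) ?_
  exact ⟨1 / 2, 1 / 2, by norm_num, by norm_num, by norm_num, by simp⟩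

theorem exists_mem_inputResponses (hUconv : Convex ℝ U) (hU : Bornology.IsBounded U)
    (hU0 : 0 ∈ interior U)
    (hctrl : ∀ ψ : (Fin n → ℝ) →ₗ[ℝ] ℝ, (∀ (k : ℕ) (w : Fin m → ℝ), ψ ((A ^ k) (B w)) = 0) → ψ = 0)
    {N : Submodule ℝ (Fin n → ℝ)} (hN : ∀ x ∈ N, A x ∈ N) {p : Polynomial ℝ} (hp : p.Monic)
    (hroots : ∀ z : ℂ, Polynomial.aeval z p = 0 → 0 ≤ z.re)
    (hpN : ∀ x ∈ N, Polynomial.aeval (A : (Fin n → ℝ) →ₗ[ℝ] (Fin n → ℝ)) p x = 0)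
    {z : Fin n → ℝ} (hz : z ∈ N) : ∃ t : ℝ, 0 < t ∧ z ∈ inputResponses A B U t := by
  have hU0' : (0 : Fin m → ℝ) ∈ U := interior_subset hU0
  set C : Set (Fin n → ℝ) := ⋃ k : ℕ, inputResponses A B U k with hC
  have hmono : Monotone fun k : ℕ ↦ inputResponses A B U k := fun k l hkl ↦
    inputResponses_mono hU hU0' (Nat.cast_nonneg k) (Nat.cast_le.2 hkl)
  have hconv : Convex ℝ C := hmono.directed_le.convex_iUnion fun k ↦
    convex_inputResponses hU hUconv k
  have h0 : (0 : Fin n → ℝ) ∈ interior C := by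
    refine interior_mono ?_ (zero_mem_interior_inputResponses hctrl hU0)
    have := Set.subset_iUnion (fun k : ℕ ↦ inputResponses A B U k) 1
    simpa using this
  by_cases hzC : z ∈ C
  · obtain ⟨k, hk⟩ := Set.mem_iUnion.1 hzC
    exact ⟨k + 1, by positivity, inputResponses_mono hU hU0' (Nat.cast_nonneg k) (by simp) hk⟩
  exfalso
  obtain ⟨f, hf⟩ := geometric_hahn_banach_open_point hconv.interior isOpen_interior
    fun h ↦ hzC (interior_subset h)
  have hfz : 0 < f z := by simpa using hf 0 h0
  have hfC : ∀ x ∈ C, f x ≤ f z := by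
    intro x hx
    have h1 : x ∈ closure (interior C) := by
      rw [hconv.closure_interior_eq_closure_of_nonempty_interior ⟨0, h0⟩]
      exact subset_closure hx
    exact closure_minimal (fun y hy ↦ (hf y hy).le) (isClosed_le f.continuous continuous_const) h1
  obtain ⟨ρ, hρ, hball⟩ := Metric.mem_nhds_iff.1
    (mem_interior_iff_mem_nhds.1 (zero_mem_interior_inputResponses hctrl hU0))
  have hsmall : ∀ x ∈ Metric.ball (0 : Fin n → ℝ) ρ,
      Filter.Tendsto (fun j : ℕ ↦ f (flow A j x)) Filter.atTop (nhds 0) := by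
    intro x hx
    -- On each unit time interval either `x` or `-x` is appended, whichever makes the contribution
    -- to `f` equal to the absolute value.
    have hsum : ∀ k : ℕ, ∃ y ∈ inputResponses A B U k,
        f y = ∑ j ∈ Finset.range k, |f (flow A j x)| := by
      intro k
      induction k with
      | zero => exact ⟨0, zero_mem_inputResponses hU0' _, by simp⟩
      | succ k ih =>
        obtain ⟨y, hy, hfy⟩ := ih
        rcases abs_cases (f (flow A k x)) with ⟨h, _⟩ | ⟨h, _⟩
        · refine ⟨y + flow A k x, ?_, by rw [map_add, hfy, Finset.sum_range_succ, h]⟩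
          have := add_mem_inputResponses hU zero_le_one (Nat.cast_nonneg k) hy (hball hx)
          simpa using this
        · refine ⟨y + flow A k (-x), ?_, by
            rw [map_add, hfy, Finset.sum_range_succ, h, map_neg, map_neg]⟩
          have := add_mem_inputResponses hU zero_le_one (Nat.cast_nonneg k) hy
            (hball (show -x ∈ Metric.ball 0 ρ by simpa using hx))
          simpa using this
    have hs : Summable fun j : ℕ ↦ |f (flow A j x)| :=
      summable_of_sum_range_le (c := f z) (fun _ ↦ abs_nonneg _) fun k ↦ by
        obtain ⟨y, hy, hfy⟩ := hsum k
        rw [← hfy]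
        exact hfC y (Set.mem_iUnion.2 ⟨k, hy⟩)
    exact hs.of_abs.tendsto_atTop_zero
  have hall : ∀ x : Fin n → ℝ,
      Filter.Tendsto (fun j : ℕ ↦ f (flow A j x)) Filter.atTop (nhds 0) := by
    intro x
    set c : ℝ := ρ / (2 * (‖x‖ + 1)) with hc
    have hc0 : 0 < c := by positivity
    have hcx : c • x ∈ Metric.ball (0 : Fin n → ℝ) ρ := by
      rw [mem_ball_zero_iff, norm_smul, Real.norm_of_nonneg hc0.le, hc, div_mul_eq_mul_div,
        div_lt_iff₀ (by positivity)]
      nlinarith [norm_nonneg x]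
    have h := (hsmall _ hcx).const_mul c⁻¹
    simpa [hc0.ne'] using h
  exact hfz.ne' (eq_zero_of_tendsto_flow A hN hp hroots hpN (f : (Fin n → ℝ) →ₗ[ℝ] ℝ)
    (fun x _ ↦ hall x) z hz)

end Reachability

/-! ### Splitting a real polynomial by the real parts of its roots. -/

section Polynomials

open Polynomial

/-- `q` is the minimal polynomial of `z` over `ℝ`, so it divides `(X - z) (X - conj z)`. -/
theorem re_eq_of_irreducible {q : ℝ[X]} (hq : Irreducible q) (hm : q.Monic) {z w : ℂ}
    (hz : aeval z q = 0) (hw : aeval w q = 0) : w.re = z.re := by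
  set r : ℝ[X] := X ^ 2 - C (2 * z.re) * X + C (z.re ^ 2 + z.im ^ 2)
  have hev : ∀ v : ℂ, aeval v r = (v - z) * (v - (starRingEnd ℂ) z) := by
    intro v
    have h1 : z + (starRingEnd ℂ) z = 2 * z.re := by simpa using Complex.add_conj z
    have h2 : z * (starRingEnd ℂ) z = (z.re : ℂ) ^ 2 + (z.im : ℂ) ^ 2 := by
      rw [Complex.mul_conj, Complex.normSq_apply]
      push_cast
      ring
    simp only [r, map_add, map_sub, map_mul, map_pow, aeval_X, aeval_C, Complex.coe_algebraMap]
    push_cast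
    rw [← h1, ← h2]
    ring
  have hdvd : q ∣ r := by
    rw [minpoly.eq_of_irreducible_of_monic hq hz hm]
    exact minpoly.dvd ℝ z (by rw [hev, sub_self, zero_mul])
  obtain ⟨s, hs⟩ := hdvd
  have h0 : aeval w r = 0 := by rw [hs, map_mul, hw, zero_mul]
  rw [hev] at h0
  rcases mul_eq_zero.1 h0 with h | h
  · rw [sub_eq_zero.1 h]
  · rw [sub_eq_zero.1 h, Complex.conj_re]

/-- Each monic irreducible factor has roots with a single real part, so it goes entirely into `p₁`
or entirely into `p₂`. -/
theorem exists_factorization_re {p : ℝ[X]} (hp : p.Monic)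
    (hroots : ∀ z : ℂ, aeval z p = 0 → z.re ≤ 0) :
    ∃ p₁ p₂ : ℝ[X], p₁.Monic ∧ p₂.Monic ∧ p = p₁ * p₂ ∧
      (∀ z : ℂ, aeval z p₁ = 0 → z.re = 0) ∧ ∀ z : ℂ, aeval z p₂ = 0 → z.re < 0 := by
  induction hd : p.natDegree using Nat.strong_induction_on generalizing p with
  | _ d ih =>
    by_cases hu : IsUnit p
    · rw [hp.isUnit_iff] at hu
      exact ⟨1, 1, monic_one, monic_one, by simp [hu], by simp, by simp⟩
    · obtain ⟨q, hqm, hqi, r, rfl⟩ := exists_monic_irreducible_factor p hu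
      have hr : r.Monic := hqm.of_mul_monic_left hp
      have hdeg : r.natDegree < d := by
        rw [← hd, hqm.natDegree_mul hr]
        have := hqi.natDegree_pos
        omega
      obtain ⟨p₁, p₂, h1, h2, he, hr1, hr2⟩ := ih _ hdeg hr
        (fun z hz ↦ hroots z (by rw [map_mul, hz, mul_zero])) rfl
      have hq0 : ∀ z : ℂ, aeval z q = 0 → z.re ≤ 0 := fun z hz ↦
        hroots z (by rw [map_mul, hz, zero_mul])
      by_cases hneg : ∃ z : ℂ, aeval z q = 0 ∧ z.re < 0
      · obtain ⟨z, hz, hzneg⟩ := hneg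
        refine ⟨p₁, q * p₂, h1, hqm.mul h2, by rw [he]; ring, hr1, fun w hw ↦ ?_⟩
        rcases mul_eq_zero.1 ((map_mul (aeval w) q p₂).symm.trans hw) with h | h
        · rwa [re_eq_of_irreducible hqi hqm hz h]
        · exact hr2 w h
      · push Not at hneg
        refine ⟨q * p₁, p₂, hqm.mul h1, h2, by rw [he]; ring, fun w hw ↦ ?_, hr2⟩
        rcases mul_eq_zero.1 ((map_mul (aeval w) q p₁).symm.trans hw) with h | h
        · exact le_antisymm (hq0 w h) (hneg w h)
        · exact hr1 w h

end Polynomials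

theorem exists_eigenvector_pair {n : ℕ} (A : Matrix (Fin n) (Fin n) ℝ) {z : ℂ}
    (hz : Polynomial.aeval z A.charpoly = 0) :
    ∃ a b : Fin n → ℝ, (a ≠ 0 ∨ b ≠ 0) ∧ A *ᵥ a = z.re • a - z.im • b ∧
      A *ᵥ b = z.im • a + z.re • b := by
  have hdet : (Matrix.scalar (Fin n) z - A.map (algebraMap ℝ ℂ)).det = 0 := by
    rw [← Matrix.eval_charpoly, Matrix.charpoly_map, Polynomial.eval_map_algebraMap, hz]
  obtain ⟨v, hv0, hv⟩ := Matrix.exists_mulVec_eq_zero_iff.2 hdet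
  have hi : ∀ i, ∑ j, (A i j : ℂ) * v j = z * v i := by
    intro i
    have h1 := congrFun hv i
    rw [Matrix.sub_mulVec, Pi.sub_apply, Matrix.scalar_apply, Matrix.mulVec_diagonal] at h1
    simpa [Matrix.mulVec, dotProduct] using (sub_eq_zero.1 h1).symm
  refine ⟨fun i ↦ (v i).re, fun i ↦ (v i).im, ?_, ?_, ?_⟩
  · by_contra! h
    exact hv0 (funext fun i ↦ Complex.ext (congrFun h.1 i) (congrFun h.2 i))
  · ext i
    simpa [Matrix.mulVec, dotProduct] using congrArg Complex.re (hi i)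
  · ext i
    simpa [Matrix.mulVec, dotProduct, add_comm] using congrArg Complex.im (hi i)

/-! ### Energy dissipation. -/

/-- The dissipated form `β (x, y) - β (exp(A) x, exp(A) y)`. -/
noncomputable def dissipationForm {V : Type*} [NormedAddCommGroup V] [NormedSpace ℝ V]
    (A : V →L[ℝ] V) (β : LinearMap.BilinForm ℝ V) :
    LinearMap.BilinForm ℝ V :=
  β - β.compl₁₂ (flow A 1 : V →ₗ[ℝ] V) (flow A 1 : V →ₗ[ℝ] V)

theorem dissipationForm_apply {V : Type*} [NormedAddCommGroup V] [NormedSpace ℝ V]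
    {A : V →L[ℝ] V} {β : LinearMap.BilinForm ℝ V} (x y : V) :
    dissipationForm A β x y = β x y - β (flow A 1 x) (flow A 1 y) := by
  simp [dissipationForm]

section Dissipative

variable {V : Type*} [NormedAddCommGroup V] [NormedSpace ℝ V] [FiniteDimensional ℝ V]
  {A : V →L[ℝ] V} {β : LinearMap.BilinForm ℝ V}

theorem form_flow_antitone (hsymm : LinearMap.IsSymm β) (hdiss : ∀ x, β x (A x) ≤ 0) (x : V) :
    Antitone fun t : ℝ ↦ β (flow A t x) (flow A t x) := by
  have : CompleteSpace V := FiniteDimensional.complete ℝ V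
  have hd : ∀ t : ℝ, HasDerivAt (fun t : ℝ ↦ β (flow A t x) (flow A t x))
      (2 * β (flow A t x) (A (flow A t x))) t := by
    intro t
    have h1 := hasDerivAt_flow_apply A x t
    have h2 := (LinearMap.toContinuousBilinearMap β).hasFDerivAt.comp_hasDerivAt t h1
    have h3 := h2.clm_apply h1
    simp only [Function.comp_def, LinearMap.toContinuousBilinearMap_apply] at h3
    convert! h3 using 1
    rw [flow_apply_comm, two_mul]
    congr 1
    simpa using (hsymm.eq (flow A t x) (A (flow A t x)))
  refine antitone_of_deriv_nonpos (fun t ↦ (hd t).differentiableAt) fun t ↦ ?_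
  rw [(hd t).deriv]
  linarith [hdiss (flow A t x)]

/-- The dissipated form `M` is positive semidefinite and tends to `0` along orbits. By
Cauchy–Schwarz so does `M (·, y)`, which therefore vanishes on `N`. -/
theorem form_flow_one_eq (hsymm : LinearMap.IsSymm β) (hnn : ∀ x, 0 ≤ β x x) (hdiss : ∀ x, β x (A x) ≤ 0)
    {N : Submodule ℝ V} (hN : ∀ x ∈ N, A x ∈ N) {p : Polynomial ℝ} (hp : p.Monic)
    (hroots : ∀ z : ℂ, Polynomial.aeval z p = 0 → 0 ≤ z.re)
    (hpN : ∀ x ∈ N, Polynomial.aeval (A : V →ₗ[ℝ] V) p x = 0) {x : V} (hx : x ∈ N) (y : V) :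
    β (flow A 1 x) (flow A 1 y) = β x y := by
  have : CompleteSpace V := FiniteDimensional.complete ℝ V
  set M := dissipationForm A β with hM
  have hMs : LinearMap.IsSymm M := ⟨fun u v ↦ by
    have h1 := hsymm.eq u v
    have h2 := hsymm.eq (flow A 1 u) (flow A 1 v)
    simp only [RingHom.id_apply] at h1 h2 ⊢
    rw [hM, dissipationForm_apply, dissipationForm_apply, h1, h2]⟩
  have hMnn : ∀ u, 0 ≤ M u u := fun u ↦ by
    have h := form_flow_antitone hsymm hdiss u zero_le_one
    simp only [flow_zero, one_apply_eq_self] at h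
    rw [hM, dissipationForm_apply]
    linarith
  have hMlim : ∀ u, Filter.Tendsto (fun j : ℕ ↦ M (flow A j u) (flow A j u))
      Filter.atTop (nhds 0) := by
    intro u
    set E : ℕ → ℝ := fun j ↦ β (flow A j u) (flow A j u) with hE
    have hanti : Antitone E := fun i j hij ↦
      form_flow_antitone hsymm hdiss u (Nat.cast_le.2 hij)
    have hlim := tendsto_atTop_ciInf hanti ⟨0, by rintro _ ⟨j, rfl⟩; exact hnn _⟩
    -- `M` along the orbit is the difference of consecutive terms of the convergent energy sequence.
    have h := hlim.sub (hlim.comp (Filter.tendsto_add_atTop_nat 1))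
    rw [sub_self] at h
    refine h.congr fun j ↦ ?_
    rw [hM, dissipationForm_apply, ← flow_add_apply]
    simp [hE, add_comm]
  have hz := eq_zero_of_tendsto_flow A hN hp hroots hpN (LinearMap.flip M y) (fun u _ ↦ by
    have hsq : Filter.Tendsto (fun j : ℕ ↦ M (flow A j u) y ^ 2) Filter.atTop (nhds 0) := by
      refine squeeze_zero (fun _ ↦ sq_nonneg _)
        (fun j ↦ LinearMap.BilinForm.apply_sq_le_of_symm M hMnn hMs (flow A j u) y) ?_
      simpa using (hMlim u).mul_const (M y y)
    have h := hsq.sqrt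
    simp only [Real.sqrt_sq_eq_abs, Real.sqrt_zero] at h
    exact (tendsto_zero_iff_abs_tendsto_zero _).2 h) x hx
  rw [LinearMap.flip_apply, hM, dissipationForm_apply] at hz
  linarith

/-- `β x y = β (exp (jA) x) (exp (jA) y)` for all `j`; the energy of the first argument stays
bounded and that of the second tends to `0`. -/
theorem form_eq_zero_of_tendsto (hsymm : LinearMap.IsSymm β) (hnn : ∀ x, 0 ≤ β x x)
    (hdiss : ∀ x, β x (A x) ≤ 0)
    {N : Submodule ℝ V} (hN : ∀ x ∈ N, A x ∈ N) {p : Polynomial ℝ} (hp : p.Monic)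
    (hroots : ∀ z : ℂ, Polynomial.aeval z p = 0 → 0 ≤ z.re)
    (hpN : ∀ x ∈ N, Polynomial.aeval (A : V →ₗ[ℝ] V) p x = 0) {x y : V} (hx : x ∈ N)
    (hy : Filter.Tendsto (fun t : ℝ ↦ flow A t y) Filter.atTop (nhds 0)) : β x y = 0 := by
  have : CompleteSpace V := FiniteDimensional.complete ℝ V
  have hj : ∀ j : ℕ, β (flow A j x) (flow A j y) = β x y := by
    intro j
    induction j with
    | zero => simp
    | succ j ih =>
      rw [← ih, ← form_flow_one_eq hsymm hnn hdiss hN hp hroots hpN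
        (flow_mem N.closed_of_finiteDimensional hN j hx) (flow A j y), ← flow_add_apply,
        ← flow_add_apply]
      simp [add_comm]
  have hyj : Filter.Tendsto (fun j : ℕ ↦ flow A j y) Filter.atTop (nhds 0) :=
    hy.comp tendsto_natCast_atTop_atTop
  have hβ : Filter.Tendsto (fun j : ℕ ↦ β (flow A j y) (flow A j y)) Filter.atTop (nhds 0) := by
    have hc : Continuous fun v ↦ β v v :=
      (LinearMap.toContinuousBilinearMap β).continuous.clm_apply continuous_id
    exact (hc.tendsto' 0 0 (by simp)).comp hyj
  have hle : ∀ j : ℕ, β x y ^ 2 ≤ β x x * β (flow A j y) (flow A j y) := by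
    intro j
    rw [← hj j]
    refine (LinearMap.BilinForm.apply_sq_le_of_symm β hnn hsymm _ _).trans ?_
    refine mul_le_mul_of_nonneg_right ?_ (hnn _)
    simpa using form_flow_antitone hsymm hdiss x (Nat.cast_nonneg (α := ℝ) j)
  have h0 : β x y ^ 2 ≤ 0 := ge_of_tendsto' (by simpa using hβ.const_mul (β x x)) hle
  exact pow_eq_zero_iff two_ne_zero |>.1 (le_antisymm h0 (sq_nonneg _))

end Dissipative

/-! ### Dual form of the Kalman condition; location of eigenvalues. -/

theorem mulVecCLM_pow_apply {n m : ℕ} (A : Matrix (Fin n) (Fin n) ℝ)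
    (B : Matrix (Fin n) (Fin m) ℝ) (k : ℕ) (w : Fin m → ℝ) :
    (mulVecCLM A ^ k) (mulVecCLM B w) = (A ^ k * B) *ᵥ w := by
  induction k with
  | zero => simp
  | succ k ih =>
    rw [pow_succ', mul_apply_eq_comp, ih, pow_succ', mulVecCLM_apply,
      Matrix.mulVec_mulVec, Matrix.mul_assoc]

theorem IsControllable.functional_eq_zero {n m : ℕ} {A : Matrix (Fin n) (Fin n) ℝ}
    {B : Matrix (Fin n) (Fin m) ℝ} (h : IsControllable A B) (ψ : (Fin n → ℝ) →ₗ[ℝ] ℝ)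
    (hψ : ∀ (k : ℕ) (w : Fin m → ℝ), ψ ((mulVecCLM A ^ k) (mulVecCLM B w)) = 0) : ψ = 0 := by
  have htop : LinearMap.range (kalmanMatrix A B).mulVecLin = ⊤ := by
    refine Submodule.eq_top_of_finrank_eq ?_
    rw [Module.finrank_fin_fun]
    exact h
  refine LinearMap.ext fun x ↦ ?_
  obtain ⟨c, rfl⟩ : x ∈ LinearMap.range (kalmanMatrix A B).mulVecLin := htop ▸ Submodule.mem_top
  have hc : (kalmanMatrix A B).mulVecLin c = ∑ k : Fin n,
      (mulVecCLM A ^ (k : ℕ)) (mulVecCLM B fun j ↦ c (k, j)) := by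
    ext i
    simp only [mulVecCLM_pow_apply, Finset.sum_apply, Matrix.mulVecLin_apply]
    simp only [Matrix.mulVec, dotProduct, kalmanMatrix, Matrix.of_apply]
    rw [Fintype.sum_prod_type]
  rw [hc, map_sum]
  exact Finset.sum_eq_zero fun k _ ↦ hψ k _

theorem functional_eq_zero_neg {n m : ℕ} {A : (Fin n → ℝ) →L[ℝ] (Fin n → ℝ)}
    {B : (Fin m → ℝ) →L[ℝ] (Fin n → ℝ)}
    (h : ∀ ψ : (Fin n → ℝ) →ₗ[ℝ] ℝ, (∀ (k : ℕ) (w : Fin m → ℝ), ψ ((A ^ k) (B w)) = 0) → ψ = 0)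
    (ψ : (Fin n → ℝ) →ₗ[ℝ] ℝ)
    (hψ : ∀ (k : ℕ) (w : Fin m → ℝ), ψ (((-A) ^ k) (B w)) = 0) : ψ = 0 := by
  refine h ψ fun k w ↦ ?_
  have hpow : ∀ x, ((-A) ^ k) x = (-1 : ℝ) ^ k • (A ^ k) x := by
    induction k with
    | zero => simp
    | succ k ih =>
      intro x
      rw [pow_succ', mul_apply_eq_comp, ih, pow_succ' A, mul_apply_eq_comp, map_smul, pow_succ,
        neg_apply, mul_neg_one, smul_neg, neg_smul]
  have h1 := hψ k w
  rw [hpow, map_smul] at h1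
  exact (smul_eq_zero.1 h1).resolve_left (pow_ne_zero k (by norm_num))

theorem nonpos_of_eigenvector_pair {V : Type*} [AddCommGroup V] [Module ℝ V]
    {β : LinearMap.BilinForm ℝ V} {A : V →ₗ[ℝ] V} (hsymm : LinearMap.IsSymm β)
    (hnn : ∀ x, 0 ≤ β x x) (hdiss : ∀ x, β x (A x) ≤ 0) (hker : ∀ x, β x x = 0 → A x = 0)
    {σ ω : ℝ} {a b : V} (hab : a ≠ 0 ∨ b ≠ 0) (ha : A a = σ • a - ω • b)
    (hb : A b = ω • a + σ • b) : σ ≤ 0 := by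
  by_contra! hσ
  have h1 := hdiss a
  have h2 := hdiss b
  have h3 : β b a = β a b := by simpa using hsymm.eq b a
  rw [ha, map_sub, map_smul, map_smul, smul_eq_mul, smul_eq_mul] at h1
  rw [hb, map_add, map_smul, map_smul, smul_eq_mul, smul_eq_mul, h3] at h2
  have h4 := hnn a
  have h5 := hnn b
  -- In `β a (A a) + β b (A b)` the `ω` terms cancel, leaving `σ (β a a + β b b) ≤ 0`.
  have ha0 : β a a = 0 := by nlinarith [mul_nonneg hσ.le h4, mul_nonneg hσ.le h5]
  have hb0 : β b b = 0 := by nlinarith [mul_nonneg hσ.le h4, mul_nonneg hσ.le h5]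
  rw [hker a ha0] at ha
  rw [hker b hb0] at hb
  have hpos : σ ^ 2 + ω ^ 2 ≠ 0 := by positivity
  have ea : (σ ^ 2 + ω ^ 2) • a = 0 := by
    have : (σ ^ 2 + ω ^ 2) • a = σ • (σ • a - ω • b) + ω • (ω • a + σ • b) := by module
    rw [this, ← ha, ← hb, smul_zero, smul_zero, add_zero]
  have eb : (σ ^ 2 + ω ^ 2) • b = 0 := by
    have : (σ ^ 2 + ω ^ 2) • b = σ • (ω • a + σ • b) - ω • (σ • a - ω • b) := by module
    rw [this, ← ha, ← hb, smul_zero, smul_zero, sub_zero]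
  rcases hab with h | h
  · exact h ((smul_eq_zero.1 ea).resolve_left hpos)
  · exact h ((smul_eq_zero.1 eb).resolve_left hpos)

/-! ### Energy and spectrum of the port-Hamiltonian drift. -/

/-- The semi-inner product `[x, y] = ⟨x, Q y⟩` as a bilinear form. -/
noncomputable def PHSystem.form {n m : ℕ} (S : PHSystem n m) :
    LinearMap.BilinForm ℝ (Fin n → ℝ) :=
  Matrix.toLinearMap₂' ℝ S.Q

namespace PHSystem

variable {n m : ℕ} (S : PHSystem n m)

theorem form_apply (x y : Fin n → ℝ) : S.form x y = x ⬝ᵥ S.Q *ᵥ y :=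
  Matrix.toLinearMap₂'_apply' S.Q x y

theorem transpose_Q : S.Qᵀ = S.Q := by
  simpa using S.Q_psd.isHermitian.eq

theorem form_apply' (x y : Fin n → ℝ) : S.form x y = (S.Q *ᵥ x) ⬝ᵥ y := by
  rw [form_apply, Matrix.dotProduct_mulVec, ← Matrix.mulVec_transpose, transpose_Q]

theorem form_isSymm : LinearMap.IsSymm S.form :=
  ⟨fun x y ↦ by rw [RingHom.id_apply, form_apply, form_apply', dotProduct_comm]⟩

theorem form_self_nonneg (x : Fin n → ℝ) : 0 ≤ S.form x x := by
  simpa [form_apply] using S.Q_psd.dotProduct_mulVec_nonneg x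

theorem form_driftMatrix_nonpos (x : Fin n → ℝ) : S.form x (S.driftMatrix *ᵥ x) ≤ 0 := by
  have hJ : ∀ w : Fin n → ℝ, w ⬝ᵥ S.J *ᵥ w = 0 := by
    intro w
    have h1 : w ⬝ᵥ S.J *ᵥ w = w ⬝ᵥ S.Jᵀ *ᵥ w := by
      rw [Matrix.dotProduct_mulVec, ← Matrix.mulVec_transpose, dotProduct_comm]
    have h2 : w ⬝ᵥ S.J *ᵥ w = -(w ⬝ᵥ S.Jᵀ *ᵥ w) := by
      conv_lhs => rw [S.J_skew]
      rw [Matrix.neg_mulVec, dotProduct_neg]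
    linarith
  have hR : 0 ≤ (S.Q *ᵥ x) ⬝ᵥ S.R *ᵥ (S.Q *ᵥ x) := by
    simpa using S.R_psd.dotProduct_mulVec_nonneg (S.Q *ᵥ x)
  rw [form_apply', driftMatrix, ← Matrix.mulVec_mulVec, Matrix.sub_mulVec, dotProduct_sub, hJ]
  linarith

/-- Substitute for definiteness when `Q` is singular: zero energy means `Q x = 0`, and `Q` is the
right factor of `A`. -/
theorem driftMatrix_mulVec_eq_zero {x : Fin n → ℝ} (hx : S.form x x = 0) :
    S.driftMatrix *ᵥ x = 0 := by
  have h : S.Q *ᵥ x = 0 := (S.Q_psd.dotProduct_mulVec_zero_iff x).1 (by simpa [form_apply] using hx)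
  rw [driftMatrix, ← Matrix.mulVec_mulVec, h, Matrix.mulVec_zero]

theorem re_nonpos_of_charpoly_eq_zero {z : ℂ}
    (hz : Polynomial.aeval z S.driftMatrix.charpoly = 0) : z.re ≤ 0 := by
  obtain ⟨a, b, hab, ha, hb⟩ := exists_eigenvector_pair S.driftMatrix hz
  exact nonpos_of_eigenvector_pair (A := S.driftMatrix.mulVecLin) S.form_isSymm S.form_self_nonneg
    S.form_driftMatrix_nonpos (fun x hx ↦ S.driftMatrix_mulVec_eq_zero hx) hab ha hb

theorem re_nonneg_of_charpoly_neg_eq_zero {z : ℂ}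
    (hz : Polynomial.aeval z (-S.driftMatrix).charpoly = 0) : 0 ≤ z.re := by
  obtain ⟨a, b, hab, ha, hb⟩ := exists_eigenvector_pair (-S.driftMatrix) hz
  rw [Matrix.neg_mulVec, neg_eq_iff_eq_neg] at ha hb
  have h := nonpos_of_eigenvector_pair (A := S.driftMatrix.mulVecLin) (σ := -z.re) (ω := -z.im)
    S.form_isSymm S.form_self_nonneg
    S.form_driftMatrix_nonpos (fun x hx ↦ S.driftMatrix_mulVec_eq_zero hx) hab
    (by rw [Matrix.mulVecLin_apply, ha]; module) (by rw [Matrix.mulVecLin_apply, hb]; module)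
  linarith

/-- The kernels of `p₁(A)` and `p₂(A)` are complementary by coprimality and Cayley–Hamilton, and
`pᵢ` annihilates the restriction to its own kernel. -/
theorem exists_isSpectralDecomposition :
    ∃ N₁ N₂ : Submodule ℝ (Fin n → ℝ), IsSpectralDecomposition S.driftMatrix N₁ N₂ := by
  obtain ⟨p₁, p₂, -, -, hp, h1, h2⟩ := exists_factorization_re S.driftMatrix.charpoly_monic
    fun z hz ↦ S.re_nonpos_of_charpoly_eq_zero hz
  set T := Matrix.toLin' S.driftMatrix
  have hcop : IsCoprime p₁ p₂ := by
    refine (Polynomial.isCoprime_iff_aeval_ne_zero_of_isAlgClosed (k := ℝ) ℂ p₁ p₂).2 fun z ↦ ?_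
    by_contra! h
    exact (h2 z h.2).ne (h1 z h.1)
  have hinv : ∀ p : Polynomial ℝ, ∀ x ∈ LinearMap.ker (Polynomial.aeval T p),
      T x ∈ LinearMap.ker (Polynomial.aeval T p) := by
    intro p x hx
    have hc : Polynomial.aeval T p * T = T * Polynomial.aeval T p := by
      simpa using (Polynomial.commute_X p |>.symm.map (Polynomial.aeval T)).eq
    rw [LinearMap.mem_ker] at hx ⊢
    rw [← Module.End.mul_apply, hc, Module.End.mul_apply, hx, map_zero]
  have hzero : ∀ p : Polynomial ℝ, Polynomial.aeval (T.restrict (hinv p)) p = 0 := by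
    intro p
    ext1 x
    refine Subtype.ext ?_
    rw [coe_aeval_restrict_apply]
    simp
  refine ⟨LinearMap.ker (Polynomial.aeval T p₁), LinearMap.ker (Polynomial.aeval T p₂),
    ⟨Polynomial.disjoint_ker_aeval_of_isCoprime T hcop, ?_⟩, hinv p₁, hinv p₂,
    fun z hz ↦ h1 z (aeval_eq_zero_of_mem_complexSpectrum (hzero p₁) hz),
    fun z hz ↦ h2 z (aeval_eq_zero_of_mem_complexSpectrum (hzero p₂) hz)⟩
  rw [codisjoint_iff, Polynomial.sup_ker_aeval_eq_ker_aeval_mul_of_coprime T hcop, ← hp,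
    ← Matrix.charpoly_toLin', LinearMap.aeval_self_charpoly, LinearMap.ker_zero]

end PHSystem

/-! ### Exponential decay and the two inclusions. -/

theorem tendsto_flow_of_norm_le {n : ℕ} {A : (Fin n → ℝ) →L[ℝ] (Fin n → ℝ)} {x : Fin n → ℝ}
    {ω C : ℝ} (hω : 0 < ω) (hC : ∀ t : ℝ, 0 ≤ t → ‖flow A t x‖ ≤ C * Real.exp (-ω * t)) :
    Filter.Tendsto (fun t : ℝ ↦ flow A t x) Filter.atTop (nhds 0) := by
  refine squeeze_zero_norm' (Filter.eventually_atTop.2 ⟨0, hC⟩) ?_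
  have h : Filter.Tendsto (fun t : ℝ ↦ -ω * t) Filter.atTop Filter.atBot :=
    Filter.tendsto_id.const_mul_atTop_of_neg (neg_neg_of_pos hω)
  simpa using (Real.tendsto_exp_atBot.comp h).const_mul C

theorem norm_integral_flow_le {n m : ℕ} {A : (Fin n → ℝ) →L[ℝ] (Fin n → ℝ)}
    {B : (Fin m → ℝ) →L[ℝ] (Fin n → ℝ)} {ω M : ℝ} {C : Fin m → ℝ} (hω : 0 < ω) (hC0 : ∀ j, 0 ≤ C j)
    (hC : ∀ j, ∀ t : ℝ, 0 ≤ t → ‖flow A t (B (Pi.single j 1))‖ ≤ C j * Real.exp (-ω * t))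
    (hM : 0 ≤ M) {u : ℝ → Fin m → ℝ} (hu : ∀ s, ‖u s‖ ≤ M) {t : ℝ} (ht : 0 ≤ t) :
    ‖∫ s in (0 : ℝ)..t, flow A s (B (u s))‖ ≤ M * (∑ j, C j) / ω := by
  set D : ℝ := M * ∑ j, C j with hD
  have hD0 : 0 ≤ D := mul_nonneg hM (Finset.sum_nonneg fun j _ ↦ hC0 j)
  have hb : ∀ s : ℝ, 0 ≤ s → ‖flow A s (B (u s))‖ ≤ D * Real.exp (-ω * s) := by
    intro s hs
    have h1 := clm_pi_apply_eq_sum ((flow A s).comp B) (u s)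
    simp only [ContinuousLinearMap.comp_apply] at h1
    rw [h1, hD, mul_assoc, Finset.sum_mul, Finset.mul_sum]
    refine (norm_sum_le _ _).trans (Finset.sum_le_sum fun j _ ↦ ?_)
    rw [norm_smul]
    exact mul_le_mul ((norm_le_pi_norm (u s) j).trans (hu s)) (hC j s hs) (norm_nonneg _) hM
  have hexp : Continuous fun s : ℝ ↦ D * Real.exp (-ω * s) := by fun_prop
  refine (intervalIntegral.norm_integral_le_of_norm_le ht
    (Filter.Eventually.of_forall fun s hs ↦ hb s hs.1.le) (hexp.intervalIntegrable 0 t)).trans ?_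
  have hd : ∀ s : ℝ, HasDerivAt (fun s : ℝ ↦ -(D / ω) * Real.exp (-ω * s))
      (D * Real.exp (-ω * s)) s := by
    intro s
    convert! (((hasDerivAt_id s).const_mul (-ω)).exp).const_mul (-(D / ω)) using 1
    simp only [id_eq]
    field_simp
  rw [intervalIntegral.integral_eq_sub_of_hasDerivAt (fun s _ ↦ hd s) (hexp.intervalIntegrable 0 t)]
  have h2 : 0 ≤ D / ω * Real.exp (-ω * t) := by positivity
  simp only [mul_zero, Real.exp_zero, mul_one]
  linarith

section Decomposition

variable {n m : ℕ} {A : Matrix (Fin n) (Fin n) ℝ} {B : Matrix (Fin n) (Fin m) ℝ}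
  {U : Set (Fin m → ℝ)} {N₁ N₂ : Submodule ℝ (Fin n → ℝ)}

theorem mem_reachableSet_iff (hU : IsCompact U) (h0 : 0 ∈ U) (x₀ z : Fin n → ℝ) :
    z ∈ reachableSet A B U x₀ ↔ ∃ t : ℝ, 0 ≤ t ∧
      z - flow (mulVecCLM A) t x₀ ∈ inputResponses (mulVecCLM A) (mulVecCLM B) U t := by
  constructor
  · rintro (rfl | hz)
    · exact ⟨0, le_rfl, by simpa using zero_mem_inputResponses h0 0⟩
    · obtain ⟨t, ht, hz⟩ := Set.mem_iUnion₂.1 hz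
      exact ⟨t, (Set.mem_Ioi.1 ht).le, (mem_reachableAt_iff hU h0 (Set.mem_Ioi.1 ht).le _ _).1 hz⟩
  · rintro ⟨t, ht, hz⟩
    rcases ht.eq_or_lt with rfl | ht
    · obtain ⟨u, -, -, hu⟩ := hz
      left
      simpa [sub_eq_zero] using hu.symm
    · exact Or.inr (Set.mem_iUnion₂.2 ⟨t, ht, (mem_reachableAt_iff hU h0 ht.le _ _).2 hz⟩)

theorem IsSpectralDecomposition.exists_norm_flow_le (h : IsSpectralDecomposition A N₁ N₂) :
    ∃ ω : ℝ, 0 < ω ∧ ∀ x ∈ N₂, ∃ C : ℝ, 0 ≤ C ∧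
      ∀ t : ℝ, 0 ≤ t → ‖flow (mulVecCLM A) t x‖ ≤ C * Real.exp (-ω * t) :=
  _root_.exists_norm_flow_le (mulVecCLM A)
    (fun x hx ↦ by simpa using h.invariant₂ x hx)
    (LinearMap.charpoly_monic ((Matrix.toLin' A).restrict h.invariant₂))
    (fun z hz ↦ h.hurwitz z ((mem_complexSpectrum_iff _ z).2 hz))
    (fun x hx ↦ aeval_charpoly_restrict_apply _ h.invariant₂ hx)

theorem IsSpectralDecomposition.reachableSet_subset (h : IsSpectralDecomposition A N₁ N₂)
    (hU : IsCompact U) (h0 : 0 ∈ U) (x₀ : Fin n → ℝ) :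
    ∃ K : Set (Fin n → ℝ), K ⊆ (N₂ : Set (Fin n → ℝ)) ∧ Bornology.IsBounded K ∧
      reachableSet A B U x₀ ⊆ (N₁ : Set (Fin n → ℝ)) + K := by
  set 𝓐 := mulVecCLM A with h𝓐
  set π : (Fin n → ℝ) →L[ℝ] (Fin n → ℝ) :=
    LinearMap.toContinuousLinearMap (N₂.projection N₁ h.isCompl.symm) with hπ
  have hπmem : ∀ x, π x ∈ N₂ := fun x ↦ Submodule.projection_apply_mem h.isCompl.symm x
  have hπ₂ : ∀ x ∈ N₂, π x = x := fun x hx ↦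
    Submodule.projection_apply_of_mem_left h.isCompl.symm hx
  have hπ₁ : ∀ x ∈ N₁, π x = 0 := fun x hx ↦ by
    have := (Submodule.projectionOnto_apply_eq_zero_iff h.isCompl.symm).2 hx
    simp [hπ, Submodule.projection_apply, this]
  have hsub : ∀ x, x - π x ∈ N₁ := fun x ↦ by
    rw [← Submodule.projectionOnto_apply_eq_zero_iff h.isCompl.symm, map_sub, sub_eq_zero]
    exact (Submodule.projectionOnto_apply_left h.isCompl.symm
      (N₂.projectionOnto N₁ h.isCompl.symm x)).symm
  have hcomm : Commute π 𝓐 := by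
    ext1 x
    change π (𝓐 x) = 𝓐 (π x)
    have e1 : 𝓐 x = 𝓐 (x - π x) + 𝓐 (π x) := by rw [← map_add, sub_add_cancel]
    have m1 : 𝓐 (x - π x) ∈ N₁ := by simpa [h𝓐] using h.invariant₁ _ (hsub x)
    have m2 : 𝓐 (π x) ∈ N₂ := by simpa [h𝓐] using h.invariant₂ _ (hπmem x)
    rw [e1, map_add, hπ₁ _ m1, hπ₂ _ m2, zero_add]
  obtain ⟨ω, hω, hdecay⟩ := h.exists_norm_flow_le
  obtain ⟨C₀, hC₀, hx₀⟩ := hdecay (π x₀) (hπmem x₀)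
  choose C hC0 hC using fun j : Fin m ↦
    hdecay ((π.comp (mulVecCLM B)) (Pi.single j 1)) (hπmem _)
  obtain ⟨M, hM0, hM⟩ := hU.isBounded.exists_pos_norm_le
  -- `K` is the projection of the reachable set onto `N₂`; only its boundedness needs work.
  refine ⟨π '' reachableSet A B U x₀, ?_, ?_, ?_⟩
  · rintro _ ⟨x, -, rfl⟩
    exact hπmem x
  · refine isBounded_iff_forall_norm_le.2 ⟨M * (∑ j, C j) / ω + C₀, ?_⟩
    rintro _ ⟨z, hz, rfl⟩
    obtain ⟨t, ht, u, hu, huU, hz⟩ := (mem_reachableSet_iff hU h0 x₀ z).1 hz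
    rw [← h𝓐] at hz
    have hflow : ∀ s x, π (flow 𝓐 s x) = flow 𝓐 s (π x) := fun s x ↦
      DFunLike.congr_fun (commute_flow hcomm s) x
    have h1 : π z = (∫ s in (0 : ℝ)..t, flow 𝓐 s ((π.comp (mulVecCLM B)) (u s))) +
        flow 𝓐 t (π x₀) := by
      have h2 := congrArg π hz
      rw [← π.intervalIntegral_comp_comm (intervalIntegrable_flow_control _ _
        (intervalIntegrable_of_forall_mem hU.isBounded hu huU 0 t)), map_sub, hflow] at h2
      simp only [hflow] at h2
      exact (eq_sub_iff_add_eq.1 h2).symm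
    rw [h1]
    refine (norm_add_le _ _).trans (add_le_add
      (norm_integral_flow_le hω hC0 hC hM0.le (fun s ↦ hM _ (huU s)) ht) ?_)
    refine (hx₀ t ht).trans (mul_le_of_le_one_right hC₀ (Real.exp_le_one_iff.2 ?_))
    nlinarith
  · intro z hz
    exact ⟨z - π z, hsub z, π z, ⟨z, hz, rfl⟩, sub_add_cancel z _⟩

end Decomposition

namespace PHSystem

variable {n m : ℕ} {S : PHSystem n m} {U : Set (Fin m → ℝ)} {N₁ N₂ : Submodule ℝ (Fin n → ℝ)}

theorem isQOrthogonal (h : IsSpectralDecomposition S.driftMatrix N₁ N₂) :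
    IsQOrthogonal S.Q N₁ N₂ := by
  intro x hx y hy
  obtain ⟨ω, hω, hdecay⟩ := h.exists_norm_flow_le
  obtain ⟨C, -, hC⟩ := hdecay y hy
  rw [← form_apply']
  exact form_eq_zero_of_tendsto (A := mulVecCLM S.driftMatrix) S.form_isSymm S.form_self_nonneg
    (fun x ↦ by simpa using S.form_driftMatrix_nonpos x)
    (fun x hx ↦ by simpa using h.invariant₁ x hx)
    (LinearMap.charpoly_monic ((Matrix.toLin' S.driftMatrix).restrict h.invariant₁))
    (fun z hz ↦ (h.imaginary z ((mem_complexSpectrum_iff _ z).2 hz)).ge)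
    (fun x hx ↦ aeval_charpoly_restrict_apply _ h.invariant₁ hx) hx
    (tendsto_flow_of_norm_le hω hC)

theorem add_subset_reachableSet (h : IsSpectralDecomposition S.driftMatrix N₁ N₂)
    (hUconv : Convex ℝ U) (hUcomp : IsCompact U) (hU0 : 0 ∈ interior U)
    (hctrl : IsControllable S.driftMatrix S.inputMatrix) (x₀ : Fin n → ℝ) :
    (N₁ : Set (Fin n → ℝ)) +
        (reachableSet S.driftMatrix S.inputMatrix U 0 ∩ (N₂ : Set (Fin n → ℝ)))
      ⊆ reachableSet S.driftMatrix S.inputMatrix U x₀ := by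
  have h0 : (0 : Fin m → ℝ) ∈ U := interior_subset hU0
  have hUb := hUcomp.isBounded
  set 𝓐 := mulVecCLM S.driftMatrix with h𝓐
  have hinv : ∀ x ∈ N₁, 𝓐 x ∈ N₁ := fun x hx ↦ by simpa [h𝓐] using h.invariant₁ x hx
  rintro _ ⟨z₁, hz₁, z₂, ⟨hz₂, -⟩, rfl⟩
  obtain ⟨t, ht, hz₂⟩ := (mem_reachableSet_iff hUcomp h0 0 z₂).1 hz₂
  rw [map_zero, sub_zero] at hz₂
  -- The target is `exp (-tA) z₁`, so that the drift during the last `t` units of time, used to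
  -- produce `z₂`, carries it to `z₁`.
  obtain ⟨t₁, ht₁, hw⟩ := exists_mem_inputResponses hUconv hUb hU0 hctrl.functional_eq_zero hinv
    (LinearMap.charpoly_monic ((Matrix.toLin' S.driftMatrix).restrict h.invariant₁))
    (fun z hz ↦ (h.imaginary z ((mem_complexSpectrum_iff _ z).2 hz)).ge)
    (fun x hx ↦ aeval_charpoly_restrict_apply _ h.invariant₁ hx)
    (flow_mem N₁.closed_of_finiteDimensional hinv (-t) hz₁)
  -- Steering `x₀` to `0` amounts to reaching `-x₀` from `0` with drift `-A`, whose eigenvalues all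
  -- have nonnegative real part.
  obtain ⟨t₀, ht₀, hv⟩ := exists_mem_inputResponses (A := -𝓐) (N := ⊤) hUconv hUb hU0
    (functional_eq_zero_neg hctrl.functional_eq_zero) (fun _ _ ↦ Submodule.mem_top)
    (-S.driftMatrix).charpoly_monic (fun z hz ↦ S.re_nonneg_of_charpoly_neg_eq_zero hz)
    (fun x _ ↦ by
      have he : ((-𝓐 : (Fin n → ℝ) →L[ℝ] (Fin n → ℝ)) : (Fin n → ℝ) →ₗ[ℝ] (Fin n → ℝ)) =
          Matrix.toLin' (-S.driftMatrix) := by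
        refine LinearMap.ext fun y ↦ ?_
        simp [h𝓐]
      rw [he, ← Matrix.charpoly_toLin', LinearMap.aeval_self_charpoly, LinearMap.zero_apply])
    (z := -x₀) Submodule.mem_top
  refine (mem_reachableSet_iff hUcomp h0 x₀ _).2 ⟨t + t₁ + t₀, by positivity, ?_⟩
  have h1 := add_mem_inputResponses hUb ht₁.le ht hz₂ hw
  rw [flow_apply_flow_neg] at h1
  have h2 := add_mem_inputResponses hUb ht₀.le (by positivity) h1 (flow_mem_inputResponses hUb hv)
  rw [← flow_add_apply, map_neg, ← sub_eq_add_neg, add_comm z₂] at h2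
  exact h2

end PHSystem

theorem corollaryt {n m : ℕ} (S : PHSystem n m)
    (U : Set (Fin m → ℝ)) (hUconv : Convex ℝ U) (hUcomp : IsCompact U) (hU0 : 0 ∈ interior U)
    (hctrl : IsControllable S.driftMatrix S.inputMatrix) :
    (∃ N₁ N₂ : Submodule ℝ (Fin n → ℝ), IsSpectralDecomposition S.driftMatrix N₁ N₂) ∧
    ∀ N₁ N₂ : Submodule ℝ (Fin n → ℝ), IsSpectralDecomposition S.driftMatrix N₁ N₂ →
      IsQOrthogonal S.Q N₁ N₂ ∧
      (∀ x₀ : Fin n → ℝ, ∃ K : Set (Fin n → ℝ),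
        K ⊆ (N₂ : Set (Fin n → ℝ)) ∧ Bornology.IsBounded K ∧
        (N₁ : Set (Fin n → ℝ)) +
            (reachableSet S.driftMatrix S.inputMatrix U 0 ∩ (N₂ : Set (Fin n → ℝ)))
          ⊆ reachableSet S.driftMatrix S.inputMatrix U x₀ ∧
        reachableSet S.driftMatrix S.inputMatrix U x₀ ⊆ (N₁ : Set (Fin n → ℝ)) + K) ∧
      (∀ x₀ : Fin n → ℝ,
        (N₁ : Set (Fin n → ℝ)) ⊆ reachableSet S.driftMatrix S.inputMatrix U x₀) := by
  refine ⟨S.exists_isSpectralDecomposition, fun N₁ N₂ h ↦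
    ⟨PHSystem.isQOrthogonal h, fun x₀ ↦ ?_, fun x₀ z hz ↦ ?_⟩⟩
  · obtain ⟨K, hK₂, hKb, hK⟩ := h.reachableSet_subset hUcomp (interior_subset hU0) x₀
    exact ⟨K, hK₂, hKb, PHSystem.add_subset_reachableSet h hUconv hUcomp hU0 hctrl x₀, hK⟩
  · exact PHSystem.add_subset_reachableSet h hUconv hUcomp hU0 hctrl x₀
      ⟨z, hz, 0, ⟨Or.inl rfl, N₂.zero_mem⟩, add_zero z⟩
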